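/- For a finite graph $G$ and integers $\kappa,\ell$, let $\Lambda_{\kappa,\ell}(G)$ be the number of $\kappa$-element subsets of $V(G)$ that span exactly $\ell$ edges of $G$, let $\Lambda_{\kappa,\ell}(n)$ be the maximum of $\Lambda_{\kappa,\ell}(G)$ over all graphs $G$ with $n$ vertices, and, for $n\ge\kappa$ and a graph $G$ with $n$ vertices, let $\lambda_{\kappa,\ell}(G):=\Lambda_{\kappa,\ell}(G)/\binom n\kappa$ and $\lambda_{\kappa,\ell}(n):=\Lambda_{\kappa,\ell}(n)/\binom n\kappa$. A pattern is a finite graph in which loops (but no multiple edges) are allowed. A blowup of a pattern $B$ with vertex set $\{0,\dots,m-1\}$ is a loopless graph whose vertex set is partitioned into (possibly empty) parts $V_0,\dots,V_{m-1}$ such that distinct $x\in V_i$ and $y\in V_j$ are adjacent if and only if $\{i,j\}\in E(B)$. For a graph $G$, let $\delta_{\mathrm{edit}}(G,B)$ be the smallest number of pairs of vertices whose adjacency has to be changed to turn $G$ into a blowup of $B$ ($+\infty$ if there is no blowup of $B$ with $|V(G)|$ vertices). **Theorem.** (a) There is $n_0$ such that every graph $G$ with $n\ge n_0$ vertices and $\Lambda_{4,3}(G)=\Lambda_{4,3}(n)$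 is isomorphic to a disjoint union of two cliques $K_a\sqcup K_b$ or to a complete bipartite graph $K_{a,b}$ for some integers $a,b\ge 0$ with $a+b=n$. (b) Perfect stability fails for the $(4,3)$-problem, even if finitely many patterns are allowed: for every finite set $\mathcal B$ of patterns there is no constant $C>0$ such that every graph $G$ with $n\ge C$ vertices satisfies $$\min_{B\in\mathcal B}\delta_{\mathrm{edit}}(G,B)\le C\,\bigl(\lambda_{4,3}(n)-\lambda_{4,3}(G)\bigr)\,n^2 .$$ In particular, the $(4,3)$-problem is not perfectly $B$-stable for any pattern $B$. -/

import Mathlib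

/-- The number of `κ`-element sets of vertices of `G` that span exactly `ℓ` edges of `G`. -/
noncomputable def edgeStatCount (κ ℓ : ℕ) {V : Type*} [Fintype V] (G : SimpleGraph V) : ℕ :=
  {X : Finset V | X.card = κ ∧ (G.induce (X : Set V)).edgeSet.ncard = ℓ}.ncard

open scoped Classical in
/-- The maximum of `edgeStatCount κ ℓ G` over all graphs `G` on `n` vertices. -/
noncomputable def maxEdgeStatCount (κ ℓ n : ℕ) : ℕ :=
  (Finset.univ : Finset (SimpleGraph (Fin n))).sup (fun G => edgeStatCount κ ℓ G)

/-- The proportion of `κ`-element sets of vertices of `G` that span exactly `ℓ` edges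
(meaningful when `G` has at least `κ` vertices). -/
noncomputable def edgeStatDensity (κ ℓ : ℕ) {V : Type*} [Fintype V] (G : SimpleGraph V) : ℝ :=
  (edgeStatCount κ ℓ G : ℝ) / ((Fintype.card V).choose κ : ℝ)

/-- The maximum of `edgeStatDensity κ ℓ G` over all graphs `G` on `n` vertices
(meaningful when `κ ≤ n`). -/
noncomputable def maxEdgeStatDensity (κ ℓ n : ℕ) : ℝ :=
  (maxEdgeStatCount κ ℓ n : ℝ) / (n.choose κ : ℝ)

/-- A pattern: a finite graph, without multiple edges, in which loops are allowed. -/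
structure LoopPattern where
  /-- The number of vertices. -/
  order : ℕ
  /-- Adjacency; `Adj i i` means that there is a loop at `i`. -/
  Adj : Fin order → Fin order → Prop
  symm : ∀ i j, Adj i j → Adj j i

/-- The blowup of the pattern `B` on the vertex set `V` whose parts are the (possibly empty)
fibres of `f`: distinct `x`, `y` are adjacent exactly when the parts they lie in are adjacent. -/
def LoopPattern.blowup (B : LoopPattern) {V : Type*} (f : V → Fin B.order) : SimpleGraph V where
  Adj x y := x ≠ y ∧ B.Adj (f x) (f y)
  symm := ⟨fun _ _ h => ⟨h.1.symm, B.symm _ _ h.2⟩⟩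
  loopless := ⟨fun _ h => h.1 rfl⟩

/-- The number of pairs of vertices whose adjacency differs in `G` and `H`. -/
noncomputable def editCount {V : Type*} (G H : SimpleGraph V) : ℕ :=
  (symmDiff G.edgeSet H.edgeSet).ncard

/-- Perfect stability of the `(κ, ℓ)`-problem with respect to a set `P` of allowed patterns:
for some `C > 0`, every graph `G` on `n ≥ C` vertices can be turned into a blowup of some `B ∈ P`
by at most `C (λ(n) - λ(G)) n ^ 2` edits. For `P = {B}` this is perfect `B`-stability. -/
def IsPerfectlyStable (κ ℓ : ℕ) (P : Set LoopPattern) : Prop :=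
  ∃ C : ℝ, 0 < C ∧ ∀ n : ℕ, C ≤ (n : ℝ) → ∀ G : SimpleGraph (Fin n),
    ∃ B ∈ P, ∃ f : Fin n → Fin B.order,
      (editCount G (B.blowup f) : ℝ) ≤
        C * (maxEdgeStatDensity κ ℓ n - edgeStatDensity κ ℓ G) * (n : ℝ) ^ 2

/-!
# Graphs with the maximal number of four-sets spanning three edges

Graphs are handled as symmetric, irreflexive functions `a : V → V → Bool`, and four-sets as ordered
quadruples: `quadCount a` is `24` times the number of four-sets that span three edges.

*Stability.* Averaging an explicit inequality on six vertices, `sixSum_neg_or_flipPair`, shows that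
`quadCount a ≤ n ^ 4 / 2`, and that a graph near this bound has few six-tuples on which the
inequality is strict (`card_sixSum_neg_le`). Where it is an equality, the four-sets that carry a
four-cycle with an odd number of edges are very restricted: there are none, or they are those
that contain a fixed pair. Hence two disjoint ones force a strict six-set (`exists_sixSum_neg`), and a
near-optimal graph has only `o(n ^ 4)` of them. So the parity of the number of edges is the same for
almost all triples, and the graph or its complement is close to a complete bipartite graph
(`exists_discrepancy_le_or_coAdj`). As complementing preserves `quadCount`, only the bipartite case
has to be considered.

*Exactness.* Let an extremal graph be close to a complete bipartite graph whose sides `A`, `B` are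
chosen with the fewest wrong pairs. Replacing the neighbourhood of a vertex by the opposite side
shows that every vertex has few wrong pairs (`sum_wrong_le`); deleting an edge inside a side would
then be a gain, so there is none (`no_edge_inside`). If `k` cross pairs are missing, at most `M` of
them at each vertex, `quadCount_le_of_bipartite` bounds the gain over the complete bipartite graph by
`24 k ((n - (A - B) ^ 2) / 2 + 3 M - k)`. On the other hand `quadCount` of a complete bipartite graph
is `((n ^ 2 - 3 n + 4) ^ 2 - ((A - B) ^ 2 - (3 n - 4)) ^ 2) / 2`. A gain requires `(A - B) ^ 2` to be
at most about `n`, where the second square costs more than the gain; so `k = 0` (`exists_eq_bip`).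

*Failure of perfect stability.* The complete bipartite graph with two sides of `m` vertices minus a
perfect matching, `crown m`, has a density that differs from the maximum by `O(n ^ (-2))`, so perfect
stability would turn it into a blowup by a bounded number of edits. But `m - K ^ 2` edits are needed
to reach a blowup of a pattern with at most `K` vertices (`le_editCount_crown`).
-/

namespace EdgeStat

open Finset

set_option linter.unusedSectionVars false

/-! ### A certificate on six vertices -/

/-- The weight of four vertices with adjacencies `ab, …, cd`. With `σ = 1` for edges and `σ = -1` for
non-edges it equals `6 · [three edges] - 3 + σ_ab σ_cd + σ_ac σ_bd + σ_ad σ_bc`. Summed over all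
four-tuples the last three terms give `3 (∑ σ) ^ 2 ≥ 0`, so an upper bound for the total weight
bounds the number of four-tuples with three edges. The weight is `0` whenever all three four-cycles
on the four vertices have an even number of edges. -/
def quadWeight (ab ac ad bc bd cd : Bool) : ℤ :=
  let σ : Bool → ℤ := fun b => cond b 1 (-1)
  cond (Nat.beq (ab.toNat + ac.toNat + ad.toNat + bc.toNat + bd.toNat + cd.toNat) 3) 3 (-3)
    + σ ab * σ cd + σ ac * σ bd + σ ad * σ bc

/-- Some four-cycle on the four vertices has an odd number of edges. The parities of the three
four-cycles add up to `0`, so it suffices to look at two of them. -/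
def oddCycle (ab ac ad bc bd cd : Bool) : Bool :=
  (ab ^^ bc ^^ cd ^^ ad) || (ac ^^ bc ^^ bd ^^ ad)

/-- The isomorphism type, with roots `x`, `y` and non-roots `z`, `w` in this order, as a five-bit
number. All adjacencies are taken relative to `xy`, so complementary graphs have the same index. -/
def flagIndex (xy xz yz xw yw zw : Bool) : ℕ :=
  (xy ^^ xz).toNat + 2 * (xy ^^ yz).toNat + 4 * (xy ^^ xw).toNat + 8 * (xy ^^ yw).toNat
    + 16 * (xy ^^ zw).toNat

/-- A function of four vertices, antisymmetric in the roots `x`, `y` and symmetric in `z`, `w`.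
Together with `flagB` and `flagC` it is part of a positive semidefinite certificate; the tables are
justified only by the finite check `bitsCheck_eq`. -/
def flagA (xy xz yz xw yw zw : Bool) : ℤ :=
  [0, 2, -2, 0, 2, 7, 0, 2, -2, 0, -7, -2, 0, 2, -2, 0, 0, 2, -2, 0, 2, 0, 0, -1, -2, 0, 0, 1, 0,
    -1, 1, 0].getD (flagIndex xy xz yz xw yw zw) 0

/-- A second function antisymmetric in the roots, see `flagA`. -/
def flagB (xy xz yz xw yw zw : Bool) : ℤ :=
  [0, 1, -1, 0, 1, 0, 0, 3, -1, 0, 0, -3, 0, 3, -3, 0, 0, 2, -2, 0, 2, 0, 0, 1, -2, 0, 0, -1, 0,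
    1, -1, 0].getD (flagIndex xy xz yz xw yw zw) 0

/-- A function symmetric in the roots, see `flagA`. -/
def flagC (xy xz yz xw yw zw : Bool) : ℤ :=
  [0, 1, 1, -2, 1, 0, 0, -3, 1, 0, 0, -3, -2, -3, -3, 0, 6, 5, 5, 0, 5, 0, 0, 1, 5, 0, 0, 1, 0,
    1, 1, -2].getD (flagIndex xy xz yz xw yw zw) 0

/-- The diagonal quadratic form of the certificate, polarized: for fixed `x`, `y` its sum over all
`a, b, c, d` is a combination of squares with positive coefficients. -/
def flagForm (xy xa ya xb yb ab xc yc xd yd cd : Bool) : ℤ :=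
  12 * (flagA xy xa ya xb yb ab * flagA xy xc yc xd yd cd)
    + 11 * (flagB xy xa ya xb yb ab * flagB xy xc yc xd yd cd)
    + 7 * (flagC xy xa ya xb yb ab * flagC xy xc yc xd yd cd)

/-- The contribution of the roots `x`, `y` and the remaining vertices `a, b, c, d` to the certificate:
the weight of `abcd`, plus the quadratic form on the three splittings of `abcd` into two pairs. -/
def rootTerm (xy xa xb xc xd ya yb yc yd ab ac ad bc bd cd : Bool) : ℤ :=
  147 * quadWeight ab ac ad bc bd cd
    + 2 * (flagForm xy xa ya xb yb ab xc yc xd yd cd + flagForm xy xa ya xc yc ac xb yb xd yd bd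
      + flagForm xy xa ya xd yd ad xb yb xc yc bc)

/-- `rootTerm` for six vertices of a graph on `ℕ`. -/
def rootTermAt (h : ℕ → ℕ → Bool) (x y a b c d : ℕ) : ℤ :=
  rootTerm (h x y) (h x a) (h x b) (h x c) (h x d) (h y a) (h y b) (h y c) (h y d) (h a b) (h a c)
    (h a d) (h b c) (h b d) (h c d)

/-- The sum of `rootTerm` over the fifteen choices of two roots among the six vertices `0, …, 5`, in
terms of the fifteen adjacencies. -/
def sixBits (b01 b02 b12 b03 b13 b23 b04 b14 b24 b34 b05 b15 b25 b35 b45 : Bool) : ℤ :=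
  rootTerm b01 b02 b03 b04 b05 b12 b13 b14 b15 b23 b24 b25 b34 b35 b45
  + rootTerm b02 b01 b03 b04 b05 b12 b23 b24 b25 b13 b14 b15 b34 b35 b45
  + rootTerm b03 b01 b02 b04 b05 b13 b23 b34 b35 b12 b14 b15 b24 b25 b45
  + rootTerm b04 b01 b02 b03 b05 b14 b24 b34 b45 b12 b13 b15 b23 b25 b35
  + rootTerm b05 b01 b02 b03 b04 b15 b25 b35 b45 b12 b13 b14 b23 b24 b34
  + rootTerm b12 b01 b13 b14 b15 b02 b23 b24 b25 b03 b04 b05 b34 b35 b45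
  + rootTerm b13 b01 b12 b14 b15 b03 b23 b34 b35 b02 b04 b05 b24 b25 b45
  + rootTerm b14 b01 b12 b13 b15 b04 b24 b34 b45 b02 b03 b05 b23 b25 b35
  + rootTerm b15 b01 b12 b13 b14 b05 b25 b35 b45 b02 b03 b04 b23 b24 b34
  + rootTerm b23 b02 b12 b24 b25 b03 b13 b34 b35 b01 b04 b05 b14 b15 b45
  + rootTerm b24 b02 b12 b23 b25 b04 b14 b34 b45 b01 b03 b05 b13 b15 b35
  + rootTerm b25 b02 b12 b23 b24 b05 b15 b35 b45 b01 b03 b04 b13 b14 b34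
  + rootTerm b34 b03 b13 b23 b35 b04 b14 b24 b45 b01 b02 b05 b12 b15 b25
  + rootTerm b35 b03 b13 b23 b34 b05 b15 b25 b45 b01 b02 b04 b12 b14 b24
  + rootTerm b45 b04 b14 b24 b34 b05 b15 b25 b35 b01 b02 b03 b12 b13 b23

/-- The adjacencies among the vertices `0, …, 4` as a number. Only graphs for which it does not drop
under a transposition of neighbouring vertices have to be checked. -/
def lowBits (b01 b02 b12 b03 b13 b23 b04 b14 b24 b34 : Bool) : ℕ :=
  b01.toNat + 2 * b02.toNat + 4 * b12.toNat + 8 * b03.toNat + 16 * b13.toNat + 32 * b23.toNat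
    + 64 * b04.toNat + 128 * b14.toNat + 256 * b24.toNat + 512 * b34.toNat

/-- Negativity of an integer, by pattern matching so that the kernel evaluates it quickly. -/
def isNeg : ℤ → Bool
  | Int.ofNat _ => false
  | Int.negSucc _ => true
/-- Vanishing of an integer, by pattern matching so that the kernel evaluates it quickly. -/
def isZero : ℤ → Bool
  | Int.ofNat n => Nat.beq n 0
  | Int.negSucc _ => false

/-- Membership of `e` in `{p, q, r, s}`. -/
def isIn (e p q r s : ℕ) : Bool := Nat.beq e p || Nat.beq e q || Nat.beq e r || Nat.beq e s

/-- Boolean version of `FlipPair`, restricted to increasing quadruples. -/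
def flipCheck (h : ℕ → ℕ → Bool) : Bool :=
  (List.range 6).any fun e => (List.range 6).any fun f => (!Nat.beq e f) && [false, true].any fun β =>
    (List.range 6).all fun p => (List.range 6).all fun q => !Nat.blt p q ||
      (List.range 6).all fun r => !Nat.blt q r || (List.range 6).all fun s => !Nat.blt r s ||
        (oddCycle (h p q) (h p r) (h p s) (h q r) (h q s) (h r s)
          == (β && isIn e p q r s && isIn f p q r s))

/-- The graph on `0, …, 5` with the given adjacencies, listed by columns. -/
def bitsGraph (b01 b02 b12 b03 b13 b23 b04 b14 b24 b34 b05 b15 b25 b35 b45 : Bool) (i j : ℕ) : Bool :=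
  [b01, b02, b12, b03, b13, b23, b04, b14, b24, b34, b05, b15, b25, b35, b45].getD
    (cond (Nat.blt i j) (j * (j - 1) / 2 + i) (i * (i - 1) / 2 + j)) false

/-- The certificate is negative, or it is zero and the graph has the structure recorded in
`FlipPair`. -/
def goodBits (b01 b02 b12 b03 b13 b23 b04 b14 b24 b34 b05 b15 b25 b35 b45 : Bool) : Bool :=
  isNeg (sixBits b01 b02 b12 b03 b13 b23 b04 b14 b24 b34 b05 b15 b25 b35 b45) ||
  (isZero (sixBits b01 b02 b12 b03 b13 b23 b04 b14 b24 b34 b05 b15 b25 b35 b45) &&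
   flipCheck (bitsGraph b01 b02 b12 b03 b13 b23 b04 b14 b24 b34 b05 b15 b25 b35 b45))

/-- Quantification over `Bool`, as a Boolean. -/
def forallBool (f : Bool → Bool) : Bool := f false && f true

/-- `goodBits` for all graphs on six vertices, apart from those whose first five vertices can be
rearranged to lower `lowBits`. -/
def bitsCheck : Bool :=
  forallBool fun b01 => forallBool fun b02 => forallBool fun b12 => forallBool fun b03 =>
  forallBool fun b13 => forallBool fun b23 => forallBool fun b04 => forallBool fun b14 =>
  forallBool fun b24 => forallBool fun b34 =>
    Nat.blt (lowBits b01 b12 b02 b13 b03 b23 b14 b04 b24 b34)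
      (lowBits b01 b02 b12 b03 b13 b23 b04 b14 b24 b34) ||
    Nat.blt (lowBits b02 b01 b12 b03 b23 b13 b04 b24 b14 b34)
      (lowBits b01 b02 b12 b03 b13 b23 b04 b14 b24 b34) ||
    Nat.blt (lowBits b01 b03 b13 b02 b12 b23 b04 b14 b34 b24)
      (lowBits b01 b02 b12 b03 b13 b23 b04 b14 b24 b34) ||
    Nat.blt (lowBits b01 b02 b12 b04 b14 b24 b03 b13 b23 b34)
      (lowBits b01 b02 b12 b03 b13 b23 b04 b14 b24 b34) ||
    (forallBool fun b05 => forallBool fun b15 => forallBool fun b25 => forallBool fun b35 =>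
     forallBool fun b45 => goodBits b01 b02 b12 b03 b13 b23 b04 b14 b24 b34 b05 b15 b25 b35 b45)

set_option maxRecDepth 100000 in
theorem bitsCheck_eq : bitsCheck = true := by decide +kernel

theorem forallBool_iff {f : Bool → Bool} : forallBool f = true ↔ ∀ b, f b = true := by
  simp [forallBool, Bool.forall_bool]

theorem isNeg_iff {z : ℤ} : isNeg z = true ↔ z < 0 := by
  cases z with
  | ofNat n => simp [isNeg]
  | negSucc n => simp [isNeg, Int.negSucc_lt_zero]

theorem isZero_iff {z : ℤ} : isZero z = true ↔ z = 0 := by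
  cases z with
  | ofNat n => cases n with
    | zero => simp [isZero]
    | succ n => simp [isZero]; omega
  | negSucc n => simp [isZero]

theorem blt_iff {a b : ℕ} : Nat.blt a b = true ↔ a < b := by
  simp [Nat.blt]

theorem isIn_iff {e p q r s : ℕ} :
    isIn e p q r s = true ↔ e = p ∨ e = q ∨ e = r ∨ e = s := by
  simp [isIn, or_assoc]

/-- The certificate `sixBits` of the first six vertices of a graph on `ℕ`. -/
def sixSum (h : ℕ → ℕ → Bool) : ℤ :=
  sixBits (h 0 1) (h 0 2) (h 1 2) (h 0 3) (h 1 3) (h 2 3) (h 0 4) (h 1 4) (h 2 4) (h 3 4)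
    (h 0 5) (h 1 5) (h 2 5) (h 3 5) (h 4 5)

/-- `oddCycle` for four vertices of a graph on `ℕ`. -/
def oddCycleAt (h : ℕ → ℕ → Bool) (p q r s : ℕ) : Bool :=
  oddCycle (h p q) (h p r) (h p s) (h q r) (h q s) (h r s)

/-- The structure of six-vertex graphs with vanishing certificate: either no four vertices carry an
odd four-cycle (`β = false`), or exactly those that contain both `e` and `f` do. In other words the
graph is obtained from a complete bipartite graph or its complement by possibly flipping one
pair. -/
def FlipPair (h : ℕ → ℕ → Bool) : Prop :=
  ∃ e f : ℕ, e < 6 ∧ f < 6 ∧ e ≠ f ∧ ∃ β : Bool, ∀ p q r s : ℕ, p < 6 → q < 6 → r < 6 → s < 6 →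
    p ≠ q → p ≠ r → p ≠ s → q ≠ r → q ≠ s → r ≠ s →
    oddCycleAt h p q r s = (β && isIn e p q r s && isIn f p q r s)

/-- A property of quadruples that is invariant under neighbouring transpositions has to be verified on
increasing quadruples only. -/
theorem forall_of_sorted {P : ℕ → ℕ → ℕ → ℕ → Prop} (h1 : ∀ p q r s, P p q r s → P q p r s)
    (h2 : ∀ p q r s, P p q r s → P p r q s) (h3 : ∀ p q r s, P p q r s → P p q s r)
    (hs : ∀ p q r s, p < q → q < r → r < s → s < 6 → P p q r s) (p q r s : ℕ) (hp : p < 6)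
    (hq : q < 6) (hr : r < 6) (hs' : s < 6) (hpq : p ≠ q) (hpr : p ≠ r) (hps : p ≠ s) (hqr : q ≠ r)
    (hqs : q ≠ s) (hrs : r ≠ s) : P p q r s := by
  have a1 : ∀ p q r s, p < q → q < r → s ≠ p → s ≠ q → s ≠ r → r < 6 → s < 6 → P p q r s := by
    intro p q r s hpq hqr h4 h5 h6 hr hs'
    rcases lt_or_gt_of_ne h6 with h6 | h6
    · apply h3
      rcases lt_or_gt_of_ne h5 with h5 | h5
      · apply h2
        rcases lt_or_gt_of_ne h4 with h4 | h4
        · exact h1 _ _ _ _ (hs _ _ _ _ h4 hpq hqr hr)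
        · exact hs _ _ _ _ h4 h5 hqr hr
      · exact hs _ _ _ _ hpq h5 h6 hr
    · exact hs _ _ _ _ hpq hqr h6 hs'
  have a2 : ∀ p q r s, p < q → r ≠ p → r ≠ q → s ≠ p → s ≠ q → s ≠ r → q < 6 → r < 6 → s < 6 →
      P p q r s := by
    intro p q r s hpq h4 h5 h6 h7 h8 hq hr hs'
    rcases lt_or_gt_of_ne h5 with h5 | h5
    · apply h2
      rcases lt_or_gt_of_ne h4 with h4 | h4
      · exact h1 _ _ _ _ (a1 _ _ _ _ h4 hpq h8 h6 h7 hq hs')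
      · exact a1 _ _ _ _ h4 h5 h6 h8 h7 hq hs'
    · exact a1 _ _ _ _ hpq h5 h6 h7 h8 hr hs'
  rcases lt_or_gt_of_ne hpq with h | h
  · exact a2 _ _ _ _ h hpr.symm hqr.symm hps.symm hqs.symm hrs.symm hq hr hs'
  · exact h1 _ _ _ _ (a2 _ _ _ _ h hqr.symm hpr.symm hqs.symm hps.symm hrs.symm hp hr hs')

theorem oddCycleAt_swap₁ {h : ℕ → ℕ → Bool} (sym : ∀ i j, h i j = h j i) (p q r s : ℕ) :
    oddCycleAt h q p r s = oddCycleAt h p q r s := by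
  unfold oddCycleAt
  rw [sym q p]
  cases h p q <;> cases h p r <;> cases h p s <;> cases h q r <;> cases h q s <;> cases h r s <;> rfl

theorem oddCycleAt_swap₂ {h : ℕ → ℕ → Bool} (sym : ∀ i j, h i j = h j i) (p q r s : ℕ) :
    oddCycleAt h p r q s = oddCycleAt h p q r s := by
  unfold oddCycleAt
  rw [sym r q]
  cases h p q <;> cases h p r <;> cases h p s <;> cases h q r <;> cases h q s <;> cases h r s <;> rfl

theorem oddCycleAt_swap₃ {h : ℕ → ℕ → Bool} (sym : ∀ i j, h i j = h j i) (p q r s : ℕ) :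
    oddCycleAt h p q s r = oddCycleAt h p q r s := by
  unfold oddCycleAt
  rw [sym s r]
  cases h p q <;> cases h p r <;> cases h p s <;> cases h q r <;> cases h q s <;> cases h r s <;> rfl

theorem flipPair_of_flipCheck {h h' : ℕ → ℕ → Bool} (sym : ∀ i j, h i j = h j i)
    (hh : ∀ i j, i < j → j < 6 → h' i j = h i j) (hc : flipCheck h' = true) : FlipPair h := by
  simp only [flipCheck, List.any_eq_true, List.mem_range, Bool.and_eq_true, List.all_eq_true,
    Bool.or_eq_true, Bool.not_eq_true', beq_iff_eq] at hc
  obtain ⟨e, he, f, hf, hef, β, -, H⟩ := hc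
  refine ⟨e, f, he, hf, Nat.ne_of_beq_eq_false hef, β, ?_⟩
  refine forall_of_sorted ?_ ?_ ?_ ?_
  · intro p q r s H'
    rw [oddCycleAt_swap₁ sym, H']
    simp only [isIn, Bool.or_comm (Nat.beq e q), Bool.or_comm (Nat.beq f q)]
  · intro p q r s H'
    rw [oddCycleAt_swap₂ sym, H']
    simp only [isIn, Bool.or_assoc, Bool.or_left_comm (Nat.beq e r), Bool.or_left_comm (Nat.beq f r)]
  · intro p q r s H'
    rw [oddCycleAt_swap₃ sym, H']
    simp only [isIn, Bool.or_assoc, Bool.or_comm (Nat.beq e s), Bool.or_comm (Nat.beq f s)]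
  · intro p q r s hpq hqr hrs hs
    have := H p (by omega) q (by omega)
    rcases this with h1 | h1
    · rw [blt_iff.2 hpq] at h1; exact absurd h1 (by decide)
    rcases h1 r (by omega) with h2 | h2
    · rw [blt_iff.2 hqr] at h2; exact absurd h2 (by decide)
    rcases h2 s (by omega) with h3 | h3
    · rw [blt_iff.2 hrs] at h3; exact absurd h3 (by decide)
    rw [← h3, oddCycleAt, hh p q hpq (by omega), hh p r (by omega) (by omega), hh p s (by omega) hs,
      hh q r hqr (by omega), hh q s (by omega) hs, hh r s hrs hs]

theorem FlipPair.of_swap {h : ℕ → ℕ → Bool} {σ : ℕ → ℕ} (hσ : ∀ i, σ (σ i) = i)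
    (hlt : ∀ i, i < 6 → σ i < 6) (H : FlipPair fun i j => h (σ i) (σ j)) : FlipPair h := by
  obtain ⟨e, f, he, hf, hef, β, H⟩ := H
  have inj : ∀ i j, σ i = σ j → i = j := fun i j hij => by rw [← hσ i, hij, hσ]
  refine ⟨σ e, σ f, hlt e he, hlt f hf, fun h => hef (inj _ _ h), β, ?_⟩
  intro p q r s hp hq hr hs h1 h2 h3 h4 h5 h6
  have := H (σ p) (σ q) (σ r) (σ s) (hlt p hp) (hlt q hq) (hlt r hr) (hlt s hs)
    (fun h => h1 (inj _ _ h)) (fun h => h2 (inj _ _ h)) (fun h => h3 (inj _ _ h))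
    (fun h => h4 (inj _ _ h)) (fun h => h5 (inj _ _ h)) (fun h => h6 (inj _ _ h))
  have key : ∀ e : ℕ, isIn e (σ p) (σ q) (σ r) (σ s) = isIn (σ e) p q r s := by
    intro e
    rw [Bool.eq_iff_iff, isIn_iff, isIn_iff]
    have : ∀ x, e = σ x ↔ σ e = x := fun x => ⟨fun h => by rw [h, hσ], fun h => by rw [← h, hσ]⟩
    simp only [this]
  rw [key, key] at this
  rw [← this]
  simp only [oddCycleAt, hσ]

theorem flags_swap_roots (xy xz yz xw yw zw : Bool) :
    flagA xy yz xz yw xw zw = -flagA xy xz yz xw yw zw ∧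
    flagB xy yz xz yw xw zw = -flagB xy xz yz xw yw zw ∧
    flagC xy yz xz yw xw zw = flagC xy xz yz xw yw zw := by
  revert xy xz yz xw yw zw
  decide

theorem flags_swap_others (xy xz yz xw yw zw : Bool) :
    flagA xy xw yw xz yz zw = flagA xy xz yz xw yw zw ∧
    flagB xy xw yw xz yz zw = flagB xy xz yz xw yw zw ∧
    flagC xy xw yw xz yz zw = flagC xy xz yz xw yw zw := by
  revert xy xz yz xw yw zw
  decide

theorem quadWeight_symm (ab ac ad bc bd cd : Bool) :
    quadWeight ab bc bd ac ad cd = quadWeight ab ac ad bc bd cd ∧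
    quadWeight ac ab ad bc cd bd = quadWeight ab ac ad bc bd cd ∧
    quadWeight ab ad ac bd bc cd = quadWeight ab ac ad bc bd cd := by
  revert ab ac ad bc bd cd
  decide

theorem flagForm_swap_roots (xy xa ya xb yb ab xc yc xd yd cd : Bool) :
    flagForm xy ya xa yb xb ab yc xc yd xd cd = flagForm xy xa ya xb yb ab xc yc xd yd cd := by
  obtain ⟨h1, h2, h3⟩ := flags_swap_roots xy xa ya xb yb ab
  obtain ⟨g1, g2, g3⟩ := flags_swap_roots xy xc yc xd yd cd
  simp only [flagForm, h1, h2, h3, g1, g2, g3]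
  ring

theorem flagForm_swap_left (xy xa ya xb yb ab xc yc xd yd cd : Bool) :
    flagForm xy xb yb xa ya ab xc yc xd yd cd = flagForm xy xa ya xb yb ab xc yc xd yd cd := by
  obtain ⟨h1, h2, h3⟩ := flags_swap_others xy xa ya xb yb ab
  simp only [flagForm, h1, h2, h3]

theorem flagForm_swap_right (xy xa ya xb yb ab xc yc xd yd cd : Bool) :
    flagForm xy xa ya xb yb ab xd yd xc yc cd = flagForm xy xa ya xb yb ab xc yc xd yd cd := by
  obtain ⟨h1, h2, h3⟩ := flags_swap_others xy xc yc xd yd cd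
  simp only [flagForm, h1, h2, h3]

theorem flagForm_comm (xy xa ya xb yb ab xc yc xd yd cd : Bool) :
    flagForm xy xc yc xd yd cd xa ya xb yb ab = flagForm xy xa ya xb yb ab xc yc xd yd cd := by
  simp only [flagForm]
  ring

theorem rootTermAt_swap_roots {h : ℕ → ℕ → Bool} (sym : ∀ i j, h i j = h j i) (x y a b c d : ℕ) :
    rootTermAt h y x a b c d = rootTermAt h x y a b c d := by
  simp only [rootTermAt, rootTerm, sym y x]
  rw [flagForm_swap_roots (h x y) (h x a) (h y a) (h x b) (h y b),
    flagForm_swap_roots (h x y) (h x a) (h y a) (h x c) (h y c),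
    flagForm_swap_roots (h x y) (h x a) (h y a) (h x d) (h y d)]

theorem rootTermAt_swap₁ {h : ℕ → ℕ → Bool} (sym : ∀ i j, h i j = h j i) (x y a b c d : ℕ) :
    rootTermAt h x y b a c d = rootTermAt h x y a b c d := by
  simp only [rootTermAt, rootTerm, sym b a]
  rw [(quadWeight_symm _ _ _ _ _ _).1, flagForm_swap_left (h x y) (h x a),
    ← flagForm_comm (h x y) (h x a) (h y a) (h x d), ← flagForm_comm (h x y) (h x a) (h y a) (h x c)]
  ring

theorem rootTermAt_swap₂ {h : ℕ → ℕ → Bool} (sym : ∀ i j, h i j = h j i) (x y a b c d : ℕ) :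
    rootTermAt h x y a c b d = rootTermAt h x y a b c d := by
  simp only [rootTermAt, rootTerm, sym c b]
  rw [(quadWeight_symm _ _ _ _ _ _).2.1,
    flagForm_swap_right (h x y) (h x a) (h y a) (h x d) (h y d) (h a d) (h x b)]
  ring

theorem rootTermAt_swap₃ {h : ℕ → ℕ → Bool} (sym : ∀ i j, h i j = h j i) (x y a b c d : ℕ) :
    rootTermAt h x y a b d c = rootTermAt h x y a b c d := by
  simp only [rootTermAt, rootTerm, sym d c]
  rw [(quadWeight_symm _ _ _ _ _ _).2.2,
    flagForm_swap_right (h x y) (h x a) (h y a) (h x b) (h y b) (h a b) (h x c)]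
  ring

theorem sixSum_eq {h : ℕ → ℕ → Bool} (sym : ∀ i j, h i j = h j i) : sixSum h =
    rootTermAt h 0 1 2 3 4 5 + rootTermAt h 0 2 1 3 4 5 + rootTermAt h 0 3 1 2 4 5
    + rootTermAt h 0 4 1 2 3 5 + rootTermAt h 0 5 1 2 3 4 + rootTermAt h 1 2 0 3 4 5
    + rootTermAt h 1 3 0 2 4 5 + rootTermAt h 1 4 0 2 3 5 + rootTermAt h 1 5 0 2 3 4
    + rootTermAt h 2 3 0 1 4 5 + rootTermAt h 2 4 0 1 3 5 + rootTermAt h 2 5 0 1 3 4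
    + rootTermAt h 3 4 0 1 2 5 + rootTermAt h 3 5 0 1 2 4 + rootTermAt h 4 5 0 1 2 3 := by
  simp only [sixSum, sixBits, rootTermAt, sym 1 0, sym 2 0, sym 2 1, sym 3 0, sym 3 1, sym 3 2,
    sym 4 0, sym 4 1, sym 4 2, sym 4 3, sym 5 0, sym 5 1, sym 5 2, sym 5 3, sym 5 4]

/-- The transposition of `k` and `k + 1`. -/
def swapNext (k i : ℕ) : ℕ := if i = k then k + 1 else if i = k + 1 then k else i

theorem swapNext_swapNext (k i : ℕ) : swapNext k (swapNext k i) = i := by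
  unfold swapNext; split_ifs <;> omega

theorem swapNext_lt {k i : ℕ} (hk : k < 5) (hi : i < 6) : swapNext k i < 6 := by
  unfold swapNext; split_ifs <;> omega

theorem sixSum_swap₀ {h : ℕ → ℕ → Bool} (sym : ∀ i j, h i j = h j i) :
    sixSum (fun i j => h (swapNext 0 i) (swapNext 0 j)) = sixSum h := by
  rw [sixSum_eq sym, sixSum_eq fun i j => sym _ _]
  change rootTermAt h 1 0 2 3 4 5 + rootTermAt h 1 2 0 3 4 5 + rootTermAt h 1 3 0 2 4 5 +
    rootTermAt h 1 4 0 2 3 5 + rootTermAt h 1 5 0 2 3 4 + rootTermAt h 0 2 1 3 4 5 + rootTermAt h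
    0 3 1 2 4 5 + rootTermAt h 0 4 1 2 3 5 + rootTermAt h 0 5 1 2 3 4 + rootTermAt h 2 3 1 0 4 5 +
    rootTermAt h 2 4 1 0 3 5 + rootTermAt h 2 5 1 0 3 4 + rootTermAt h 3 4 1 0 2 5 + rootTermAt h
    3 5 1 0 2 4 + rootTermAt h 4 5 1 0 2 3 = _
  linear_combination rootTermAt_swap_roots sym 0 1 2 3 4 5 + rootTermAt_swap₁ sym 2 3 0 1 4 5 +
    rootTermAt_swap₁ sym 2 4 0 1 3 5 + rootTermAt_swap₁ sym 2 5 0 1 3 4 + rootTermAt_swap₁ sym 3 4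
    0 1 2 5 + rootTermAt_swap₁ sym 3 5 0 1 2 4 + rootTermAt_swap₁ sym 4 5 0 1 2 3

theorem sixSum_swap₁ {h : ℕ → ℕ → Bool} (sym : ∀ i j, h i j = h j i) :
    sixSum (fun i j => h (swapNext 1 i) (swapNext 1 j)) = sixSum h := by
  rw [sixSum_eq sym, sixSum_eq fun i j => sym _ _]
  change rootTermAt h 0 2 1 3 4 5 + rootTermAt h 0 1 2 3 4 5 + rootTermAt h 0 3 2 1 4 5 +
    rootTermAt h 0 4 2 1 3 5 + rootTermAt h 0 5 2 1 3 4 + rootTermAt h 2 1 0 3 4 5 + rootTermAt h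
    2 3 0 1 4 5 + rootTermAt h 2 4 0 1 3 5 + rootTermAt h 2 5 0 1 3 4 + rootTermAt h 1 3 0 2 4 5 +
    rootTermAt h 1 4 0 2 3 5 + rootTermAt h 1 5 0 2 3 4 + rootTermAt h 3 4 0 2 1 5 + rootTermAt h
    3 5 0 2 1 4 + rootTermAt h 4 5 0 2 1 3 = _
  linear_combination rootTermAt_swap₁ sym 0 3 1 2 4 5 + rootTermAt_swap₁ sym 0 4 1 2 3 5 +
    rootTermAt_swap₁ sym 0 5 1 2 3 4 + rootTermAt_swap_roots sym 1 2 0 3 4 5 + rootTermAt_swap₂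
    sym 3 4 0 1 2 5 + rootTermAt_swap₂ sym 3 5 0 1 2 4 + rootTermAt_swap₂ sym 4 5 0 1 2 3

theorem sixSum_swap₂ {h : ℕ → ℕ → Bool} (sym : ∀ i j, h i j = h j i) :
    sixSum (fun i j => h (swapNext 2 i) (swapNext 2 j)) = sixSum h := by
  rw [sixSum_eq sym, sixSum_eq fun i j => sym _ _]
  change rootTermAt h 0 1 3 2 4 5 + rootTermAt h 0 3 1 2 4 5 + rootTermAt h 0 2 1 3 4 5 +
    rootTermAt h 0 4 1 3 2 5 + rootTermAt h 0 5 1 3 2 4 + rootTermAt h 1 3 0 2 4 5 + rootTermAt h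
    1 2 0 3 4 5 + rootTermAt h 1 4 0 3 2 5 + rootTermAt h 1 5 0 3 2 4 + rootTermAt h 3 2 0 1 4 5 +
    rootTermAt h 3 4 0 1 2 5 + rootTermAt h 3 5 0 1 2 4 + rootTermAt h 2 4 0 1 3 5 + rootTermAt h
    2 5 0 1 3 4 + rootTermAt h 4 5 0 1 3 2 = _
  linear_combination rootTermAt_swap₁ sym 0 1 2 3 4 5 + rootTermAt_swap₂ sym 0 4 1 2 3 5 +
    rootTermAt_swap₂ sym 0 5 1 2 3 4 + rootTermAt_swap₂ sym 1 4 0 2 3 5 + rootTermAt_swap₂ sym 1 5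
    0 2 3 4 + rootTermAt_swap_roots sym 2 3 0 1 4 5 + rootTermAt_swap₃ sym 4 5 0 1 2 3

theorem sixSum_swap₃ {h : ℕ → ℕ → Bool} (sym : ∀ i j, h i j = h j i) :
    sixSum (fun i j => h (swapNext 3 i) (swapNext 3 j)) = sixSum h := by
  rw [sixSum_eq sym, sixSum_eq fun i j => sym _ _]
  change rootTermAt h 0 1 2 4 3 5 + rootTermAt h 0 2 1 4 3 5 + rootTermAt h 0 4 1 2 3 5 +
    rootTermAt h 0 3 1 2 4 5 + rootTermAt h 0 5 1 2 4 3 + rootTermAt h 1 2 0 4 3 5 + rootTermAt h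
    1 4 0 2 3 5 + rootTermAt h 1 3 0 2 4 5 + rootTermAt h 1 5 0 2 4 3 + rootTermAt h 2 4 0 1 3 5 +
    rootTermAt h 2 3 0 1 4 5 + rootTermAt h 2 5 0 1 4 3 + rootTermAt h 4 3 0 1 2 5 + rootTermAt h
    4 5 0 1 2 3 + rootTermAt h 3 5 0 1 2 4 = _
  linear_combination rootTermAt_swap₂ sym 0 1 2 3 4 5 + rootTermAt_swap₂ sym 0 2 1 3 4 5 +
    rootTermAt_swap₃ sym 0 5 1 2 3 4 + rootTermAt_swap₂ sym 1 2 0 3 4 5 + rootTermAt_swap₃ sym 1 5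
    0 2 3 4 + rootTermAt_swap₃ sym 2 5 0 1 3 4 + rootTermAt_swap_roots sym 3 4 0 1 2 5

/-- `lowBits` of a graph on `ℕ`. -/
def lowMask (h : ℕ → ℕ → Bool) : ℕ :=
  lowBits (h 0 1) (h 0 2) (h 1 2) (h 0 3) (h 1 3) (h 2 3) (h 0 4) (h 1 4) (h 2 4) (h 3 4)

/-- The local form of the main inequality. Adjacent transpositions preserve `sixSum`, so by induction
on `lowMask` every six-vertex graph is reduced to one covered by the finite check. -/
theorem sixSum_neg_or_flipPair {h : ℕ → ℕ → Bool} (sym : ∀ i j, h i j = h j i) :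
    sixSum h < 0 ∨ (sixSum h = 0 ∧ FlipPair h) := by
  induction hm : lowMask h using Nat.strong_induction_on generalizing h with
  | _ m ih =>
    subst hm
    have step : ∀ k < 4, sixSum (fun i j => h (swapNext k i) (swapNext k j)) = sixSum h →
        lowMask (fun i j => h (swapNext k i) (swapNext k j)) < lowMask h →
        sixSum h < 0 ∨ (sixSum h = 0 ∧ FlipPair h) := by
      intro k hk hs hlt
      rcases ih _ hlt (fun i j => sym _ _) rfl with h1 | ⟨h1, h2⟩
      · exact Or.inl (hs ▸ h1)
      · exact Or.inr ⟨hs ▸ h1, h2.of_swap (swapNext_swapNext k)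
          fun i hi => swapNext_lt (by omega) hi⟩
    have key := bitsCheck_eq
    simp only [bitsCheck, forallBool_iff, Bool.or_eq_true, blt_iff] at key
    have := key (h 0 1) (h 0 2) (h 1 2) (h 0 3) (h 1 3) (h 2 3) (h 0 4) (h 1 4) (h 2 4) (h 3 4)
    rcases this with (((h1 | h1) | h1) | h1) | h1
    · refine step 0 (by norm_num) (sixSum_swap₀ sym) (lt_of_eq_of_lt ?_ h1)
      rw [← sym 1 0]; rfl
    · refine step 1 (by norm_num) (sixSum_swap₁ sym) (lt_of_eq_of_lt ?_ h1)
      rw [← sym 2 1]; rfl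
    · refine step 2 (by norm_num) (sixSum_swap₂ sym) (lt_of_eq_of_lt ?_ h1)
      rw [← sym 3 2]; rfl
    · refine step 3 (by norm_num) (sixSum_swap₃ sym) (lt_of_eq_of_lt ?_ h1)
      rw [← sym 4 3]; rfl
    · have h2 := h1 (h 0 5) (h 1 5) (h 2 5) (h 3 5) (h 4 5)
      simp only [goodBits, Bool.or_eq_true, Bool.and_eq_true, isNeg_iff, isZero_iff] at h2
      rcases h2 with h2 | ⟨h2, h3⟩
      · exact Or.inl h2
      · refine Or.inr ⟨h2, flipPair_of_flipCheck sym ?_ h3⟩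
        intro i j hij hj
        interval_cases j <;> interval_cases i <;> rfl

/-! ### Averaging the certificate over six-tuples -/

section

theorem sum_finCons {V M : Type*} [Fintype V] [DecidableEq V] [AddCommMonoid M] {k : ℕ}
    (F : (Fin (k + 1) → V) → M) : ∑ v, F v = ∑ x, ∑ v : Fin k → V, F (Fin.cons x v) := by
  rw [← (Fin.consEquiv (fun _ => V)).sum_comp, Fintype.sum_prod_type]
  rfl

theorem sum_fin_six {V M : Type*} [Fintype V] [DecidableEq V] [AddCommMonoid M]
    (f : V → V → V → V → V → V → M) :
    ∑ v : Fin 6 → V, f (v 0) (v 1) (v 2) (v 3) (v 4) (v 5)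
      = ∑ x, ∑ y, ∑ a, ∑ b, ∑ c, ∑ d, f x y a b c d := by
  simp only [sum_finCons, Fintype.sum_unique]
  rfl

/-- Reindexing the positions of a tuple. -/
theorem sum_comp_perm {ι V M : Type*} [Fintype ι] [DecidableEq ι] [Fintype V] [AddCommMonoid M]
    (e : Equiv.Perm ι) (F : (ι → V) → M) : ∑ v : ι → V, F (v ∘ e) = ∑ v, F v :=
  (Equiv.arrowCongr e.symm (Equiv.refl V)).sum_comp F

variable {V : Type*} (a : V → V → Bool)

/-- The graph induced on a six-tuple of vertices, as a function on `ℕ` (read modulo `6`). -/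
def pullback (v : Fin 6 → V) (i j : ℕ) : Bool := a (v (Fin.ofNat 6 i)) (v (Fin.ofNat 6 j))

/-- `rootTerm` for vertices of `a`. -/
def rootTermOn (x y p q r s : V) : ℤ :=
  rootTerm (a x y) (a x p) (a x q) (a x r) (a x s) (a y p) (a y q) (a y r) (a y s) (a p q) (a p r)
    (a p s) (a q r) (a q s) (a r s)

/-- `flagForm` for vertices of `a`. -/
def flagFormOn (x y p q r s : V) : ℤ :=
  flagForm (a x y) (a x p) (a y p) (a x q) (a y q) (a p q) (a x r) (a y r) (a x s) (a y s) (a r s)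

/-- `quadWeight` for vertices of `a`. -/
def quadWeightOn (p q r s : V) : ℤ :=
  quadWeight (a p q) (a p r) (a p s) (a q r) (a q s) (a r s)

theorem rootTermOn_eq (x y p q r s : V) : rootTermOn a x y p q r s =
    147 * quadWeightOn a p q r s + 2 * (flagFormOn a x y p q r s + flagFormOn a x y p r q s
      + flagFormOn a x y p s q r) := rfl

variable [Fintype V] [DecidableEq V]

theorem sum_rootTermAt (t : Fin 6 → Fin 6) (ht : Function.Bijective t) :
    ∑ v : Fin 6 → V, rootTermAt (pullback a v) (t 0) (t 1) (t 2) (t 3) (t 4) (t 5)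
      = ∑ v : Fin 6 → V, rootTermOn a (v 0) (v 1) (v 2) (v 3) (v 4) (v 5) := by
  refine Eq.trans (Finset.sum_congr rfl fun v _ => ?_) (sum_comp_perm (Equiv.ofBijective t ht)
    fun v => rootTermOn a (v 0) (v 1) (v 2) (v 3) (v 4) (v 5))
  simp only [rootTermAt, rootTermOn, pullback, Function.comp, Equiv.ofBijective_apply]
  have : ∀ i : Fin 6, Fin.ofNat 6 (i : ℕ) = i := by decide
  simp only [this]

theorem sum_sixSum (sym : ∀ x y, a x y = a y x) :
    ∑ v : Fin 6 → V, sixSum (pullback a v)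
      = 15 * ∑ v : Fin 6 → V, rootTermOn a (v 0) (v 1) (v 2) (v 3) (v 4) (v 5) := by
  have key := fun t ht => sum_rootTermAt a t ht
  have e : ∀ v : Fin 6 → V, sixSum (pullback a v) = _ :=
    fun v => sixSum_eq (h := pullback a v) fun i j => sym _ _
  simp only [e, Finset.sum_add_distrib]
  have h1 := key ![0, 1, 2, 3, 4, 5] (by decide)
  have h2 := key ![0, 2, 1, 3, 4, 5] (by decide)
  have h3 := key ![0, 3, 1, 2, 4, 5] (by decide)
  have h4 := key ![0, 4, 1, 2, 3, 5] (by decide)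
  have h5 := key ![0, 5, 1, 2, 3, 4] (by decide)
  have h6 := key ![1, 2, 0, 3, 4, 5] (by decide)
  have h7 := key ![1, 3, 0, 2, 4, 5] (by decide)
  have h8 := key ![1, 4, 0, 2, 3, 5] (by decide)
  have h9 := key ![1, 5, 0, 2, 3, 4] (by decide)
  have h10 := key ![2, 3, 0, 1, 4, 5] (by decide)
  have h11 := key ![2, 4, 0, 1, 3, 5] (by decide)
  have h12 := key ![2, 5, 0, 1, 3, 4] (by decide)
  have h13 := key ![3, 4, 0, 1, 2, 5] (by decide)
  have h14 := key ![3, 5, 0, 1, 2, 4] (by decide)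
  have h15 := key ![4, 5, 0, 1, 2, 3] (by decide)
  change _ = _ at h1 h2 h3 h4 h5 h6 h7 h8 h9 h10 h11 h12 h13 h14 h15
  erw [h1, h2, h3, h4, h5, h6, h7, h8, h9, h10, h11, h12, h13, h14, h15]
  ring

/-- For fixed roots the quadratic form sums to a combination of three squares. -/
theorem sum_flagFormOn_nonneg (x y : V) :
    0 ≤ ∑ p, ∑ q, ∑ r, ∑ s, flagFormOn a x y p q r s := by
  have key : ∀ f : V → V → ℤ,
      ∑ p, ∑ q, ∑ r, ∑ s, f p q * f r s = (∑ p, ∑ q, f p q) ^ 2 := by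
    intro f
    simp only [sq, ← Finset.mul_sum, ← Finset.sum_mul]
  have e : ∑ p, ∑ q, ∑ r, ∑ s, flagFormOn a x y p q r s =
      12 * (∑ p, ∑ q, flagA (a x y) (a x p) (a y p) (a x q) (a y q) (a p q)) ^ 2
      + 11 * (∑ p, ∑ q, flagB (a x y) (a x p) (a y p) (a x q) (a y q) (a p q)) ^ 2
      + 7 * (∑ p, ∑ q, flagC (a x y) (a x p) (a y p) (a x q) (a y q) (a p q)) ^ 2 := by
    simp only [← key, Finset.mul_sum, ← Finset.sum_add_distrib]
    rfl
  rw [e]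
  positivity

theorem sum_rootTermOn_ge :
    147 * (Fintype.card V : ℤ) ^ 2 * ∑ p, ∑ q, ∑ r, ∑ s, quadWeightOn a p q r s
      ≤ ∑ v : Fin 6 → V, rootTermOn a (v 0) (v 1) (v 2) (v 3) (v 4) (v 5) := by
  rw [sum_fin_six (rootTermOn a)]
  have h : ∀ x y : V, ∑ p, ∑ q, ∑ r, ∑ s, rootTermOn a x y p q r s =
      147 * (∑ p, ∑ q, ∑ r, ∑ s, quadWeightOn a p q r s)
        + 6 * ∑ p, ∑ q, ∑ r, ∑ s, flagFormOn a x y p q r s := by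
    intro x y
    have h2 : ∑ p, ∑ q, ∑ r, ∑ s, flagFormOn a x y p r q s
        = ∑ p, ∑ q, ∑ r, ∑ s, flagFormOn a x y p q r s :=
      Finset.sum_congr rfl fun p _ => Finset.sum_comm
    have h3 : ∑ p, ∑ q, ∑ r, ∑ s, flagFormOn a x y p s q r
        = ∑ p, ∑ q, ∑ r, ∑ s, flagFormOn a x y p q r s := by
      refine Finset.sum_congr rfl fun p _ => ?_
      rw [Finset.sum_congr rfl fun q _ => Finset.sum_comm, Finset.sum_comm]
    simp only [rootTermOn_eq, Finset.sum_add_distrib, ← Finset.mul_sum, h2, h3]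
    ring
  simp only [h]
  have : ∑ x : V, ∑ y : V, (147 * (∑ p, ∑ q, ∑ r, ∑ s, quadWeightOn a p q r s)) ≤
    ∑ x : V, ∑ y : V, (147 * (∑ p, ∑ q, ∑ r, ∑ s, quadWeightOn a p q r s)
        + 6 * ∑ p, ∑ q, ∑ r, ∑ s, flagFormOn a x y p q r s) := by
    gcongr with x _ y _
    have := sum_flagFormOn_nonneg a x y
    linarith
  refine le_trans (le_of_eq ?_) this
  simp only [Finset.sum_const, Finset.card_univ, nsmul_eq_mul]
  ring

/-- All six-tuples are allowed here, including those with repeated vertices: the local inequality only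
uses that the pulled back adjacency is symmetric. -/
theorem sum_quadWeightOn_le (sym : ∀ x y, a x y = a y x) :
    2205 * (Fintype.card V : ℤ) ^ 2 * ∑ p, ∑ q, ∑ r, ∑ s, quadWeightOn a p q r s
      + #{v : Fin 6 → V | sixSum (pullback a v) < 0} ≤ 0 := by
  have h1 := sum_sixSum a sym
  have h2 := sum_rootTermOn_ge a
  have h3 : ∑ v : Fin 6 → V, sixSum (pullback a v)
      ≤ ∑ v : Fin 6 → V, -(if sixSum (pullback a v) < 0 then 1 else 0 : ℤ) := by
    refine Finset.sum_le_sum fun v _ => ?_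
    have := sixSum_neg_or_flipPair (h := pullback a v) fun i j => sym _ _
    split_ifs <;> omega
  rw [Finset.sum_neg_distrib, Finset.sum_boole] at h3
  linarith

/-- The number of edges spanned by four vertices. -/
def edgeSum (p q r s : V) : ℕ :=
  (a p q).toNat + (a p r).toNat + (a p s).toNat + (a q r).toNat + (a q s).toNat + (a r s).toNat

/-- Indicator of four distinct vertices that span exactly three edges. -/
def quadInd (p q r s : V) : ℝ :=
  if p ≠ q ∧ p ≠ r ∧ p ≠ s ∧ q ≠ r ∧ q ≠ s ∧ r ≠ s ∧ edgeSum a p q r s = 3 then 1 else 0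

/-- The number of ordered quadruples of distinct vertices that span exactly three edges. -/
def quadCount : ℝ := ∑ p, ∑ q, ∑ r, ∑ s, quadInd a p q r s

theorem quadWeight_cast (b₁ b₂ b₃ b₄ b₅ b₆ : Bool) :
    (quadWeight b₁ b₂ b₃ b₄ b₅ b₆ : ℝ) =
      (if b₁.toNat + b₂.toNat + b₃.toNat + b₄.toNat + b₅.toNat + b₆.toNat = 3 then 3 else -3)
        + (cond b₁ 1 (-1) * cond b₆ 1 (-1) + cond b₂ 1 (-1) * cond b₅ 1 (-1)
          + cond b₃ 1 (-1) * cond b₄ 1 (-1)) := by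
  cases b₁ <;> cases b₂ <;> cases b₃ <;> cases b₄ <;> cases b₅ <;> cases b₆ <;>
    norm_num [quadWeight, Nat.beq]

/-- Both the bound `quadCount a ≤ n ^ 4 / 2` and its stability version: if `quadCount a` is close to
`n ^ 4 / 2`, then few six-tuples have a negative certificate. -/
theorem card_sixSum_neg_le (sym : ∀ x y, a x y = a y x) :
    (#{v : Fin 6 → V | sixSum (pullback a v) < 0} : ℝ)
      ≤ 2205 * (Fintype.card V : ℝ) ^ 2 * (3 * (Fintype.card V : ℝ) ^ 4 - 6 * quadCount a) := by
  have h1 := sum_quadWeightOn_le a sym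
  have h2 : (∑ p, ∑ q, ∑ r, ∑ s, (quadWeightOn a p q r s : ℝ)) ≥
      6 * quadCount a - 3 * (Fintype.card V : ℝ) ^ 4 := by
    set σ : V → V → ℝ := fun x y => cond (a x y) 1 (-1) with hσ
    have e1 : ∑ p, ∑ q, ∑ r, ∑ s, σ p q * σ r s = (∑ p, ∑ q, σ p q) ^ 2 := by
      simp only [sq, ← Finset.mul_sum, ← Finset.sum_mul]
    have e2 : ∑ p, ∑ q, ∑ r, ∑ s, σ p r * σ q s = (∑ p, ∑ q, σ p q) ^ 2 := by
      rw [← e1]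
      exact Finset.sum_congr rfl fun p _ => Finset.sum_comm
    have e3 : ∑ p, ∑ q, ∑ r, ∑ s, σ p s * σ q r = (∑ p, ∑ q, σ p q) ^ 2 := by
      rw [← e1]
      refine Finset.sum_congr rfl fun p _ => ?_
      rw [Finset.sum_congr rfl fun q _ => Finset.sum_comm, Finset.sum_comm]
    have e4 : ∑ p, ∑ q, ∑ r, ∑ s, (6 * quadInd a p q r s - 3 + (σ p q * σ r s + σ p r * σ q s
        + σ p s * σ q r)) ≤ ∑ p, ∑ q, ∑ r, ∑ s, (quadWeightOn a p q r s : ℝ) := by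
      gcongr with p _ q _ r _ s _
      have : (quadWeightOn a p q r s : ℝ) = (if edgeSum a p q r s = 3 then 3 else -3) +
          (σ p q * σ r s + σ p r * σ q s + σ p s * σ q r) := by
        exact quadWeight_cast _ _ _ _ _ _
      rw [this]
      gcongr
      unfold quadInd
      split_ifs with h3 h4 <;> norm_num
      exact h4 h3.2.2.2.2.2.2
    simp only [Finset.sum_add_distrib, Finset.sum_sub_distrib] at e4
    rw [e1, e2, e3] at e4
    simp only [← Finset.mul_sum, Finset.sum_const, Finset.card_univ, nsmul_eq_mul] at e4
    have e5 := sq_nonneg (∑ p, ∑ q, σ p q)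
    have e6 : ∑ p, ∑ q, ∑ r, ∑ s, quadInd a p q r s = quadCount a := rfl
    rw [e6] at e4
    nlinarith
  have h3 : (2205 * (Fintype.card V : ℝ) ^ 2 * ∑ p, ∑ q, ∑ r, ∑ s, (quadWeightOn a p q r s : ℝ))
      + #{v : Fin 6 → V | sixSum (pullback a v) < 0} ≤ 0 := by exact_mod_cast h1
  have h4 := mul_le_mul_of_nonneg_left h2 (by positivity : 0 ≤ 2205 * (Fintype.card V : ℝ) ^ 2)
  linarith

end

/-! ### Odd four-cycles and closeness to a bipartition -/

section

/-- Some four-cycle on `p, q, r, s` has an odd number of edges. -/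
def oddFour {V : Type*} (a : V → V → Bool) (p q r s : V) : Bool :=
  oddCycle (a p q) (a p r) (a p s) (a q r) (a q s) (a r s)

/-- The triangle `x, y, z` has an odd number of edges. -/
def oddTriple {V : Type*} (a : V → V → Bool) (x y z : V) : Bool := a x y ^^ a y z ^^ a x z

theorem exists_flip_pair {V : Type*} {a : V → V → Bool} (sym : ∀ x y, a x y = a y x)
    {v : Fin 6 → V} (hv : Function.Injective v) (h : ¬ sixSum (pullback a v) < 0) :
    ∃ e f : V, e ≠ f ∧ ∃ β : Prop, ∀ p ∈ Set.range v, ∀ q ∈ Set.range v, ∀ r ∈ Set.range v,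
      ∀ s ∈ Set.range v, p ≠ q → p ≠ r → p ≠ s → q ≠ r → q ≠ s → r ≠ s →
      (oddFour a p q r s = true ↔ β ∧ (e = p ∨ e = q ∨ e = r ∨ e = s)
        ∧ (f = p ∨ f = q ∨ f = r ∨ f = s)) := by
  obtain h' | ⟨-, e, f, he, hf, hef, β, H⟩ :=
    sixSum_neg_or_flipPair (h := pullback a v) fun i j => sym _ _
  · exact absurd h' h
  refine ⟨v ⟨e, he⟩, v ⟨f, hf⟩, fun h => hef (by simpa using hv h), β = true, ?_⟩
  rintro _ ⟨p, rfl⟩ _ ⟨q, rfl⟩ _ ⟨r, rfl⟩ _ ⟨s, rfl⟩ h1 h2 h3 h4 h5 h6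
  have ne : ∀ {i j : Fin 6}, v i ≠ v j → (i : ℕ) ≠ j := fun h h' => h (congrArg v (Fin.ext h'))
  have key := H p q r s p.2 q.2 r.2 s.2 (ne h1) (ne h2) (ne h3) (ne h4) (ne h5) (ne h6)
  have this : ∀ i : Fin 6, Fin.ofNat 6 (i : ℕ) = i := by decide
  simp only [oddCycleAt, pullback, this] at key
  rw [oddFour, key, Bool.and_eq_true, Bool.and_eq_true, isIn_iff, isIn_iff, and_assoc]
  simp only [hv.eq_iff, Fin.ext_iff]

/-- Two disjoint quadruples with odd four-cycles force a six-subset with negative certificate.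
Otherwise the flip pair `e, f` of the first quadruple `0123` is the flip pair of both `012345` and
`012346`, so `ef45` and `ef46` carry odd four-cycles. In the six-subset `ef4567` the flip pair would
then have to lie in each of `4567`, `ef45` and `ef46`, which share the vertex `4` only. -/
theorem exists_sixSum_neg {a : Fin 8 → Fin 8 → Bool} (sym : ∀ x y, a x y = a y x)
    (h₁ : oddFour a 0 1 2 3 = true) (h₂ : oddFour a 4 5 6 7 = true) :
    ∃ e : Fin 6 → Fin 8, Function.Injective e ∧ sixSum (pullback a e) < 0 := by
  by_contra! hcon
  have key := fun (e : Fin 6 → Fin 8) (he : Function.Injective e) =>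
    exists_flip_pair sym he (not_lt.2 (hcon e he))
  obtain ⟨e, f, hef, β, H1⟩ := key ![0, 1, 2, 3, 4, 5] (by decide)
  obtain ⟨e', f', hef', β', H2⟩ := key ![0, 1, 2, 3, 4, 6] (by decide)
  have m1 : ∀ x ∈ ({0, 1, 2, 3, 4, 5} : Finset (Fin 8)),
      x ∈ Set.range (![0, 1, 2, 3, 4, 5] : Fin 6 → Fin 8) := by decide
  have m2 : ∀ x ∈ ({0, 1, 2, 3, 4, 6} : Finset (Fin 8)),
      x ∈ Set.range (![0, 1, 2, 3, 4, 6] : Fin 6 → Fin 8) := by decide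
  replace H1 := fun p hp q hq r hr s hs => H1 p (m1 p hp) q (m1 q hq) r (m1 r hr) s (m1 s hs)
  replace H2 := fun p hp q hq r hr s hs => H2 p (m2 p hp) q (m2 q hq) r (m2 r hr) s (m2 s hs)
  obtain ⟨hβ, he, hf⟩ := (H1 0 (by decide) 1 (by decide) 2 (by decide) 3 (by decide) (by decide)
    (by decide) (by decide) (by decide) (by decide) (by decide)).1 h₁
  obtain ⟨hβ', he', hf'⟩ := (H2 0 (by decide) 1 (by decide) 2 (by decide) 3 (by decide) (by decide)
    (by decide) (by decide) (by decide) (by decide) (by decide)).1 h₁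
  have hcd : ∀ e f : Fin 8, e ≠ f → (e = 0 ∨ e = 1 ∨ e = 2 ∨ e = 3) →
      (f = 0 ∨ f = 1 ∨ f = 2 ∨ f = 3) → ∃ c d : Fin 8, c ≠ d ∧ c ≠ e ∧ c ≠ f ∧ d ≠ e ∧ d ≠ f ∧
        (c = 0 ∨ c = 1 ∨ c = 2 ∨ c = 3) ∧ (d = 0 ∨ d = 1 ∨ d = 2 ∨ d = 3) := by decide
  obtain ⟨c, d, h1, h2, h3, h4, h5, hc, hd⟩ := hcd e f hef he hf
  have lt1 : ∀ x : Fin 8, (x = 0 ∨ x = 1 ∨ x = 2 ∨ x = 3) →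
      x ∈ ({0, 1, 2, 3, 4, 5} : Finset (Fin 8)) ∧ x ∈ ({0, 1, 2, 3, 4, 6} : Finset (Fin 8)) ∧
      x ≠ 4 ∧ x ≠ 5 ∧ x ≠ 6 ∧ x ≠ 7 := by decide
  obtain ⟨c1, c2, c4, -, -, -⟩ := lt1 c hc
  obtain ⟨d1, d2, d4, -, -, -⟩ := lt1 d hd
  obtain ⟨e1, e2, e4, e5, e6, e7⟩ := lt1 e he
  obtain ⟨f1, f2, f4, f5, f6, f7⟩ := lt1 f hf
  obtain ⟨-, -, e4', -, -, -⟩ := lt1 e' he'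
  obtain ⟨-, -, f4', -, -, -⟩ := lt1 f' hf'
  have b1 := (H1 e e1 f f1 c c1 4 (by decide) hef h2.symm e4 h3.symm f4 c4).2
    ⟨hβ, Or.inl rfl, Or.inr (Or.inl rfl)⟩
  have b2 := (H1 e e1 f f1 d d1 4 (by decide) hef h4.symm e4 h5.symm f4 d4).2
    ⟨hβ, Or.inl rfl, Or.inr (Or.inl rfl)⟩
  have b3 := (H1 e e1 f f1 4 (by decide) 5 (by decide) hef e4 e5 f4 f5 (by decide)).2
    ⟨hβ, Or.inl rfl, Or.inr (Or.inl rfl)⟩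
  have i1 := (H2 e e2 f f2 c c2 4 (by decide) hef h2.symm e4 h3.symm f4 c4).1 b1
  have i2 := (H2 e e2 f f2 d d2 4 (by decide) hef h4.symm e4 h5.symm f4 d4).1 b2
  have b4 := (H2 e e2 f f2 4 (by decide) 6 (by decide) hef e4 e6 f4 f6 (by decide)).2
    ⟨hβ', by grind, by grind⟩
  have inj : Function.Injective (![e, f, 4, 5, 6, 7] : Fin 6 → Fin 8) := by
    have : ∀ e f : Fin 8, e ≠ f ∧ (e = 0 ∨ e = 1 ∨ e = 2 ∨ e = 3) ∧
        (f = 0 ∨ f = 1 ∨ f = 2 ∨ f = 3) →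
        Function.Injective (![e, f, 4, 5, 6, 7] : Fin 6 → Fin 8) := by decide
    exact this e f ⟨hef, he, hf⟩
  obtain ⟨p, q, hpq, γ, H3⟩ := key ![e, f, 4, 5, 6, 7] inj
  have me : e ∈ Set.range (![e, f, 4, 5, 6, 7] : Fin 6 → Fin 8) := ⟨0, rfl⟩
  have mf : f ∈ Set.range (![e, f, 4, 5, 6, 7] : Fin 6 → Fin 8) := ⟨1, rfl⟩
  have n4 : 4 ∈ Set.range (![e, f, 4, 5, 6, 7] : Fin 6 → Fin 8) := ⟨2, rfl⟩
  have n5 : 5 ∈ Set.range (![e, f, 4, 5, 6, 7] : Fin 6 → Fin 8) := ⟨3, rfl⟩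
  have n6 : 6 ∈ Set.range (![e, f, 4, 5, 6, 7] : Fin 6 → Fin 8) := ⟨4, rfl⟩
  have n7 : 7 ∈ Set.range (![e, f, 4, 5, 6, 7] : Fin 6 → Fin 8) := ⟨5, rfl⟩
  have j1 := (H3 4 n4 5 n5 6 n6 7 n7 (by decide) (by decide) (by decide) (by decide) (by decide)
    (by decide)).1 h₂
  have j2 := (H3 e me f mf 4 n4 5 n5 hef e4 e5 f4 f5 (by decide)).1 b3
  have j3 := (H3 e me f mf 4 n4 6 n6 hef e4 e6 f4 f6 (by decide)).1 b4
  have only : ∀ p : Fin 8, (p = 4 ∨ p = 5 ∨ p = 6 ∨ p = 7) → (p = e ∨ p = f ∨ p = 4 ∨ p = 5) →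
      (p = e ∨ p = f ∨ p = 4 ∨ p = 6) → p = 4 := by
    clear * - e4 e5 e6 e7 f4 f5 f6 f7
    rintro p (rfl | rfl | rfl | rfl) h h'
    · rfl
    · simp [e5.symm, f5.symm] at h'
    · simp [e6.symm, f6.symm] at h
    · simp [e7.symm, f7.symm] at h
  exact hpq ((only p j1.2.1 j2.2.1 j3.2.1).trans (only q j1.2.2 j2.2.2 j3.2.2).symm)

/-- Each `k`-tuple extends to at most `n ^ (m - k)` many `m`-tuples with prescribed entries at the
positions `e`. -/
theorem card_comp_le {V : Type*} [Fintype V] [DecidableEq V] {k m : ℕ} {e : Fin k → Fin m}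
    (he : Function.Injective e) (P : (Fin k → V) → Prop) [DecidablePred P] :
    #{v : Fin m → V | P (v ∘ e)} ≤ Fintype.card V ^ (m - k) * #{u : Fin k → V | P u} := by
  have h1 : Fintype.card ({i : Fin m // i ∉ Set.range e} → V) = Fintype.card V ^ (m - k) := by
    rw [Fintype.card_fun, Fintype.card_subtype_compl]
    congr 2
    · simp
    · exact (Fintype.card_congr (Equiv.ofInjective e he)).symm.trans (Fintype.card_fin k)
  rw [← h1, ← Finset.card_univ, mul_comm, ← Finset.card_product]
  refine Finset.card_le_card_of_injOn (fun v => (v ∘ e, fun i => v i)) ?_ ?_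
  · intro v hv
    simpa using hv
  · intro v _ w _ hvw
    simp only [Prod.mk.injEq] at hvw
    funext i
    by_cases hi : i ∈ Set.range e
    · obtain ⟨j, rfl⟩ := hi
      exact congrFun hvw.1 j
    · exact congrFun hvw.2 ⟨i, hi⟩

theorem card_mul_card_append {V : Type*} [Fintype V] [DecidableEq V] {k m : ℕ}
    (P : (Fin k → V) → Prop) (Q : (Fin m → V) → Prop) [DecidablePred P] [DecidablePred Q] :
    #{u : Fin k → V | P u} * #{u : Fin m → V | Q u} ≤
      #{v : Fin (k + m) → V | P (v ∘ Fin.castAdd m) ∧ Q (v ∘ Fin.natAdd k)} := by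
  rw [← Finset.card_product]
  refine Finset.card_le_card_of_injOn (fun v => Fin.append v.1 v.2) ?_ ?_
  · rintro ⟨u, w⟩ hv
    have e1 : Fin.append u w ∘ Fin.castAdd m = u := by funext i; simp
    have e2 : Fin.append u w ∘ Fin.natAdd k = w := by funext i; simp
    simpa [e1, e2] using hv
  · rintro ⟨u, w⟩ _ ⟨u', w'⟩ _ h
    simpa using (Fin.appendEquiv k m).injective (a₁ := (u, w)) (a₂ := (u', w')) h

variable {V : Type*} [Fintype V] [DecidableEq V]

theorem card_oddFour_sq_le {a : V → V → Bool} (sym : ∀ x y, a x y = a y x) :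
    #{u : Fin 4 → V | oddFour a (u 0) (u 1) (u 2) (u 3) = true} ^ 2 ≤
      8 ^ 6 * (Fintype.card V ^ 2 * #{v : Fin 6 → V | sixSum (pullback a v) < 0}) := by
  rw [sq]
  refine (card_mul_card_append _ _).trans ?_
  have h1 : ({v : Fin (4 + 4) → V |
      oddFour a ((v ∘ Fin.castAdd 4) 0) ((v ∘ Fin.castAdd 4) 1) ((v ∘ Fin.castAdd 4) 2)
        ((v ∘ Fin.castAdd 4) 3) = true ∧
      oddFour a ((v ∘ Fin.natAdd 4) 0) ((v ∘ Fin.natAdd 4) 1) ((v ∘ Fin.natAdd 4) 2)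
        ((v ∘ Fin.natAdd 4) 3) = true} : Finset (Fin (4 + 4) → V)) ⊆
      ({e : Fin 6 → Fin 8 | Function.Injective e} : Finset _).biUnion
        fun e => {v : Fin 8 → V | sixSum (pullback a (v ∘ e)) < 0} := by
    intro v hv
    simp only [mem_filter, mem_univ, true_and, mem_biUnion] at hv ⊢
    exact exists_sixSum_neg (a := fun i j => a (v i) (v j)) (fun _ _ => sym _ _) hv.1 hv.2
  refine (card_le_card h1).trans (card_biUnion_le.trans ?_)
  refine (Finset.sum_le_card_nsmul _ _
    (Fintype.card V ^ 2 * #{v : Fin 6 → V | sixSum (pullback a v) < 0}) fun e he => ?_).trans ?_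
  · exact card_comp_le (m := 8) (mem_filter.1 he).2 fun v => sixSum (pullback a v) < 0
  · rw [smul_eq_mul]
    gcongr
    refine (Finset.card_filter_le _ _).trans ?_
    simp

/-- The parities of `pqr` and `qrs` differ by the parity of the four-cycle `pqsr`. -/
theorem oddFour_of_oddTriple_ne {V : Type*} {a : V → V → Bool} {p q r s : V}
    (h : oddTriple a p q r ≠ oddTriple a q r s) : oddFour a p q r s = true := by
  unfold oddTriple at h
  unfold oddFour oddCycle
  revert h
  cases a p q <;> cases a q r <;> cases a p r <;> cases a r s <;> cases a q s <;> cases a p s <;>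
    decide

/-- Moving from an odd triple `v₀v₁v₂` to an even triple `v₃v₄v₅` one vertex at a time, the parity
changes in one of the three steps, and there four consecutive vertices carry an odd four-cycle. -/
theorem card_odd_mul_card_even_le (a : V → V → Bool) :
    #{u : Fin 3 → V | oddTriple a (u 0) (u 1) (u 2) = true} *
      #{u : Fin 3 → V | ¬ oddTriple a (u 0) (u 1) (u 2) = true} ≤
      3 * (Fintype.card V ^ 2 * #{u : Fin 4 → V | oddFour a (u 0) (u 1) (u 2) (u 3) = true}) := by
  refine (card_mul_card_append _ _).trans ?_
  have k1 := card_comp_le (e := (![0, 1, 2, 3] : Fin 4 → Fin 6)) (by decide)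
    (fun u : Fin 4 → V => oddFour a (u 0) (u 1) (u 2) (u 3) = true)
  have k2 := card_comp_le (e := (![1, 2, 3, 4] : Fin 4 → Fin 6)) (by decide)
    (fun u : Fin 4 → V => oddFour a (u 0) (u 1) (u 2) (u 3) = true)
  have k3 := card_comp_le (e := (![2, 3, 4, 5] : Fin 4 → Fin 6)) (by decide)
    (fun u : Fin 4 → V => oddFour a (u 0) (u 1) (u 2) (u 3) = true)
  refine (Finset.card_le_card
    (t := univ.filter (fun v : Fin 6 → V => oddFour a (v 0) (v 1) (v 2) (v 3) = true) ∪
      univ.filter (fun v : Fin 6 → V => oddFour a (v 1) (v 2) (v 3) (v 4) = true) ∪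
      univ.filter (fun v : Fin 6 → V => oddFour a (v 2) (v 3) (v 4) (v 5) = true)) ?_).trans ?_
  · intro v hv
    simp only [mem_filter, mem_univ, true_and, mem_union] at hv ⊢
    obtain ⟨h1, h2⟩ := hv
    change oddTriple a (v 0) (v 1) (v 2) = true at h1
    change ¬ oddTriple a (v 3) (v 4) (v 5) = true at h2
    by_contra! h3
    obtain ⟨⟨h3, h4⟩, h5⟩ := h3
    have g1 := not_imp_comm.1 oddFour_of_oddTriple_ne h3
    have g2 := not_imp_comm.1 oddFour_of_oddTriple_ne h4
    have g3 := not_imp_comm.1 oddFour_of_oddTriple_ne h5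
    exact h2 (by rw [← g3, ← g2, ← g1, h1])
  · refine (card_union_le _ _).trans ((add_le_add_left (card_union_le _ _) _).trans ?_)
    have e : 3 * (Fintype.card V ^ 2 *
        #{u : Fin 4 → V | oddFour a (u 0) (u 1) (u 2) (u 3) = true}) =
        Fintype.card V ^ (6 - 4) * #{u : Fin 4 → V | oddFour a (u 0) (u 1) (u 2) (u 3) = true} +
        Fintype.card V ^ (6 - 4) * #{u : Fin 4 → V | oddFour a (u 0) (u 1) (u 2) (u 3) = true} +
        Fintype.card V ^ (6 - 4) * #{u : Fin 4 → V | oddFour a (u 0) (u 1) (u 2) (u 3) = true} := by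
      ring
    rw [e]
    exact add_le_add (add_le_add k1 k2) k3

/-- Adjacency in the complement. -/
def coAdj (a : V → V → Bool) (x y : V) : Bool := !decide (x = y) && !a x y

/-- The number of ordered pairs on which `a` differs from the complete bipartite graph with sides
`s = true` and `s = false`. -/
def discrepancy (a : V → V → Bool) (s : V → Bool) : ℕ :=
  #{p : V × V | a p.1 p.2 ≠ (s p.1 ^^ s p.2)}

/-- If few triples are odd, then some vertex `v` lies in few odd triples, and `v` together with its
non-neighbours can be taken as one of the two sides. -/
theorem exists_discrepancy_le [Nonempty V] {a : V → V → Bool} {c : ℝ}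
    (h : (#{u : Fin 3 → V | oddTriple a (u 0) (u 1) (u 2) = true} : ℝ)
      ≤ c * (Fintype.card V : ℝ) ^ 3) :
    ∃ s : V → Bool, (discrepancy a s : ℝ) ≤ c * (Fintype.card V : ℝ) ^ 2 := by
  have h1 : (#{u : Fin 3 → V | oddTriple a (u 0) (u 1) (u 2) = true} : ℝ)
      = ∑ v : V, (discrepancy a (fun x => !a v x) : ℝ) := by
    rw [← Finset.sum_boole, sum_finCons]
    refine Finset.sum_congr rfl fun v _ => ?_
    rw [discrepancy, ← Finset.sum_boole, Fintype.sum_prod_type]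
    simp only [sum_finCons, Fintype.sum_unique]
    refine Finset.sum_congr rfl fun x _ => Finset.sum_congr rfl fun y _ => ?_
    refine if_congr ?_ rfl rfl
    change oddTriple a v x y = true ↔ _
    unfold oddTriple
    cases a v x <;> cases a x y <;> cases a v y <;> simp
  by_contra! hcon
  have h2 : ∑ _v : V, c * (Fintype.card V : ℝ) ^ 2 < ∑ v : V, (discrepancy a fun x => !a v x : ℝ) :=
    Finset.sum_lt_sum_of_nonempty univ_nonempty fun v _ => hcon _
  rw [← h1, Finset.sum_const, Finset.card_univ, nsmul_eq_mul] at h2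
  nlinarith

/-- Complementing changes the parity of every triple of distinct vertices, while in the complement the
degenerate triples are even. -/
theorem card_odd_coAdj_le {a : V → V → Bool} (sym : ∀ x y, a x y = a y x) :
    #{u : Fin 3 → V | oddTriple (coAdj a) (u 0) (u 1) (u 2) = true} ≤
      #{u : Fin 3 → V | ¬ oddTriple a (u 0) (u 1) (u 2) = true} := by
  refine Finset.card_le_card fun u => ?_
  simp only [oddTriple, coAdj]
  have := sym (u 1) (u 2)
  by_cases h1 : u 0 = u 1 <;> by_cases h2 : u 1 = u 2 <;> by_cases h3 : u 0 = u 2 <;>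
    simp_all

/-- Stability: a graph with almost the maximal number of quadruples is close to a complete bipartite
graph or to the complement of one. -/
theorem exists_discrepancy_le_or_coAdj {ε C : ℝ} (hε : 0 < ε) :
    ∃ n₀ : ℕ, ∀ (V : Type*) [Fintype V] [DecidableEq V] (a : V → V → Bool),
      (∀ x y, a x y = a y x) → n₀ ≤ Fintype.card V →
      (Fintype.card V : ℝ) ^ 4 / 2 - C * (Fintype.card V : ℝ) ^ 3 ≤ quadCount a →
      (∃ s : V → Bool, (discrepancy a s : ℝ) ≤ ε * (Fintype.card V : ℝ) ^ 2) ∨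
      (∃ s : V → Bool, (discrepancy (coAdj a) s : ℝ) ≤ ε * (Fintype.card V : ℝ) ^ 2) := by
  set K : ℝ := 8 ^ 6 * 2205 * 6 * C with hK
  obtain ⟨n₀, hn₀⟩ := exists_nat_gt (36 * K / ε ^ 2)
  refine ⟨n₀ + 1, fun V _ _ a sym hn hq => ?_⟩
  have hpos : 0 < Fintype.card V := by omega
  have : Nonempty V := Fintype.card_pos_iff.1 hpos
  have h1 := card_sixSum_neg_le a sym
  have h2 := card_oddFour_sq_le sym
  have h3 := card_odd_mul_card_even_le a
  have h4 := Finset.card_filter_add_card_filter_not (s := (univ : Finset (Fin 3 → V)))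
    (fun u => oddTriple a (u 0) (u 1) (u 2) = true)
  rw [Finset.card_univ, Fintype.card_fun, Fintype.card_fin] at h4
  have h5 := card_odd_coAdj_le sym
  set n : ℝ := (Fintype.card V : ℝ) with hnn
  have hn1 : (1 : ℝ) ≤ n := by rw [hnn]; exact_mod_cast hpos
  have hnK : 36 * K < ε ^ 2 * n := by
    have : 36 * K / ε ^ 2 < n := hn₀.trans_le (by rw [hnn]; exact_mod_cast (by omega))
    rwa [div_lt_iff₀ (by positivity), mul_comm n] at this
  set N := (#{v : Fin 6 → V | sixSum (pullback a v) < 0} : ℝ) with hNN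
  replace h2 : (#{u : Fin 4 → V | oddFour a (u 0) (u 1) (u 2) (u 3) = true} : ℝ) ^ 2 ≤
      8 ^ 6 * (n ^ 2 * N) := by rw [hnn, hNN]; exact_mod_cast h2
  rify at h3 h4
  rw [← hnn] at h3 h4
  set B := (#{u : Fin 4 → V | oddFour a (u 0) (u 1) (u 2) (u 3) = true} : ℝ) with hB
  set O := (#{u : Fin 3 → V | oddTriple a (u 0) (u 1) (u 2) = true} : ℝ)
  set E := (#{u : Fin 3 → V | ¬ oddTriple a (u 0) (u 1) (u 2) = true} : ℝ)
  have hB0 : 0 ≤ B := Nat.cast_nonneg _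
  -- One of `O`, `E` is at least `n ^ 3 / 2`, so if both exceed `ε n ^ 3`, their product is too large.
  by_cases hO : O ≤ ε * n ^ 3
  · exact Or.inl (exists_discrepancy_le hO)
  by_cases hE : E ≤ ε * n ^ 3
  · exact Or.inr (exists_discrepancy_le ((Nat.cast_le.2 h5).trans hE))
  exfalso
  push Not at hO hE
  have hN : N ≤ 2205 * n ^ 2 * (6 * (C * n ^ 3)) :=
    h1.trans (by gcongr; linarith)
  have hB2 : B ^ 2 ≤ K * n ^ 7 := by
    calc B ^ 2 ≤ 8 ^ 6 * (n ^ 2 * N) := h2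
      _ ≤ 8 ^ 6 * (n ^ 2 * (2205 * n ^ 2 * (6 * (C * n ^ 3)))) := by gcongr
      _ = K * n ^ 7 := by rw [hK]; ring
  have hn3 : 0 < n ^ 3 := by positivity
  have hOE : ε * n ^ 3 * (n ^ 3 / 2) < O * E := by
    have : 0 < ε * n ^ 3 := by positivity
    rcases le_total O E with h | h
    · exact mul_lt_mul hO (by linarith) (by positivity) (by linarith)
    · rw [mul_comm O]
      exact mul_lt_mul hE (by linarith) (by positivity) (by linarith)
  have hB1 : ε * n ^ 4 < 6 * B := by
    have : n ^ 2 * (ε * n ^ 4) < n ^ 2 * (6 * B) := by nlinarith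
    exact lt_of_mul_lt_mul_left this (by positivity)
  have : (ε * n ^ 4) ^ 2 < (6 * B) ^ 2 := by gcongr
  have h6 : n ^ 7 * (ε ^ 2 * n) < n ^ 7 * (36 * K) := by nlinarith
  exact absurd (lt_of_mul_lt_mul_left h6 (by positivity)) (not_lt.2 hnK.le)

end

/-! ### Counting four-tuples in bipartite graphs -/

section

/-- The real number `1` or `0` that indicates `b`. -/
def ind (b : Bool) : ℝ := cond b 1 0

@[simp] theorem ind_true : ind true = 1 := rfl
@[simp] theorem ind_false : ind false = 0 := rfl

theorem ind_nonneg (b : Bool) : 0 ≤ ind b := by cases b <;> simp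

theorem ind_le_one (b : Bool) : ind b ≤ 1 := by cases b <;> simp

theorem ind_not (b : Bool) : ind (!b) = 1 - ind b := by cases b <;> simp

theorem ind_mul_self (b : Bool) : ind b * ind b = ind b := by cases b <;> simp

/-- After the permutation `π`, the vertex in position `0` is adjacent to the other three. -/
def isStar (m : Fin 4 → Fin 4 → Bool) (π : Equiv.Perm (Fin 4)) : Bool :=
  m (π 0) (π 1) && m (π 0) (π 2) && m (π 0) (π 3)

/-- After the permutation `π`, the vertices in positions `0, 2` and `1, 3` lie on different sides and
`0 1` is the only non-adjacent cross pair. -/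
def isPath (m : Fin 4 → Fin 4 → Bool) (t : Fin 4 → Bool) (π : Equiv.Perm (Fin 4)) : Bool :=
  t (π 0) && !t (π 1) && t (π 2) && !t (π 3) &&
    !m (π 0) (π 1) && m (π 0) (π 3) && m (π 2) (π 1) && m (π 2) (π 3)

/-- The adjacency matrix on four vertices with the given entries above the diagonal. -/
def bitsMatrix (b₁ b₂ b₃ b₄ b₅ b₆ : Bool) : Fin 4 → Fin 4 → Bool :=
  ![![false, b₁, b₂, b₃], ![b₁, false, b₄, b₅], ![b₂, b₄, false, b₆], ![b₃, b₅, b₆, false]]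

set_option synthInstance.maxSize 10000 in
set_option synthInstance.maxHeartbeats 200000 in
/-- A bipartite graph on four vertices with three edges is a star, seen by the six permutations that
put its centre first, or a path with four vertices, seen by one permutation. -/
theorem sum_star_path_bits : ∀ t₀ t₁ t₂ t₃ b₁ b₂ b₃ b₄ b₅ b₆ : Bool,
    ((t₀ = t₁ → b₁ = false) ∧ (t₀ = t₂ → b₂ = false) ∧ (t₀ = t₃ → b₃ = false) ∧
      (t₁ = t₂ → b₄ = false) ∧ (t₁ = t₃ → b₅ = false) ∧ (t₂ = t₃ → b₆ = false)) →
    ∑ π : Equiv.Perm (Fin 4), ((isStar (bitsMatrix b₁ b₂ b₃ b₄ b₅ b₆) π).toNat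
      + 6 * (isPath (bitsMatrix b₁ b₂ b₃ b₄ b₅ b₆) ![t₀, t₁, t₂, t₃] π).toNat)
      = if b₁.toNat + b₂.toNat + b₃.toNat + b₄.toNat + b₅.toNat + b₆.toNat = 3 then 6 else 0 := by
  decide +kernel

variable {V : Type*} [Fintype V] [DecidableEq V]

theorem sum_star_path {a : V → V → Bool} (sym : ∀ x y, a x y = a y x) (irr : ∀ x, a x x = false)
    {t : V → Bool} (h : ∀ x y, t x = t y → a x y = false) (v : Fin 4 → V) :
    ∑ π : Equiv.Perm (Fin 4), ((isStar (fun i j => a (v i) (v j)) π).toNat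
      + 6 * (isPath (fun i j => a (v i) (v j)) (t ∘ v) π).toNat)
      = if edgeSum a (v 0) (v 1) (v 2) (v 3) = 3 then 6 else 0 := by
  have key := sum_star_path_bits (t (v 0)) (t (v 1)) (t (v 2)) (t (v 3)) (a (v 0) (v 1))
    (a (v 0) (v 2)) (a (v 0) (v 3)) (a (v 1) (v 2)) (a (v 1) (v 3)) (a (v 2) (v 3))
    ⟨h _ _, h _ _, h _ _, h _ _, h _ _, h _ _⟩
  have e1 : bitsMatrix (a (v 0) (v 1)) (a (v 0) (v 2)) (a (v 0) (v 3)) (a (v 1) (v 2))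
      (a (v 1) (v 3)) (a (v 2) (v 3)) = fun i j => a (v i) (v j) := by
    funext i j
    fin_cases i <;> fin_cases j <;> simp [bitsMatrix, irr] <;> exact sym _ _
  have e2 : ![t (v 0), t (v 1), t (v 2), t (v 3)] = t ∘ v := by
    funext i
    fin_cases i <;> rfl
  rw [e1, e2] at key
  exact key

/-- Indicator of distinct `q, r, s` that are all adjacent to `p`. -/
def starInd (a : V → V → Bool) (p q r s : V) : ℝ :=
  if q ≠ r ∧ q ≠ s ∧ r ≠ s then ind (a p q) * ind (a p r) * ind (a p s) else 0

/-- Indicator of a path `x y' x' y` with `x`, `x'` on the side `t = true` and `y`, `y'` on the other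
side whose ends `x`, `y` are not adjacent. -/
def pathInd (a : V → V → Bool) (t : V → Bool) (x y x' y' : V) : ℝ :=
  ind (t x) * ind (!t y) * ind (t x') * ind (!t y') * ind (!a x y) * ind (a x y') * ind (a x' y)
    * ind (a x' y')

theorem injective_fin_four {v : Fin 4 → V} : Function.Injective v ↔
    v 0 ≠ v 1 ∧ v 0 ≠ v 2 ∧ v 0 ≠ v 3 ∧ v 1 ≠ v 2 ∧ v 1 ≠ v 3 ∧ v 2 ≠ v 3 := by
  constructor
  · intro h
    refine ⟨?_, ?_, ?_, ?_, ?_, ?_⟩ <;> exact h.ne (by decide)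
  · rintro ⟨h1, h2, h3, h4, h5, h6⟩ i j hij
    fin_cases i <;> fin_cases j <;> simp_all

theorem sum_fin_four {M : Type*} [AddCommMonoid M] (f : V → V → V → V → M) :
    ∑ v : Fin 4 → V, f (v 0) (v 1) (v 2) (v 3) = ∑ p, ∑ q, ∑ r, ∑ s, f p q r s := by
  simp only [sum_finCons, Fintype.sum_unique]
  rfl

theorem quadInd_eq_ite (a : V → V → Bool) (v : Fin 4 → V) : quadInd a (v 0) (v 1) (v 2) (v 3) =
    if Function.Injective v ∧ edgeSum a (v 0) (v 1) (v 2) (v 3) = 3 then 1 else 0 := by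
  unfold quadInd
  refine if_congr ?_ rfl rfl
  rw [injective_fin_four]
  tauto

theorem ind_eq_toNat (b : Bool) : ind b = (b.toNat : ℝ) := by cases b <;> simp

theorem quadCount_of_bipartite {a : V → V → Bool} (sym : ∀ x y, a x y = a y x)
    (irr : ∀ x, a x x = false) {t : V → Bool} (h : ∀ x y, t x = t y → a x y = false) :
    quadCount a = 4 * ∑ p, ∑ q, ∑ r, ∑ s, starInd a p q r s
      + 24 * ∑ x, ∑ y, ∑ x', ∑ y', pathInd a t x y x' y' := by
  set F : (Fin 4 → V) → ℝ := fun v =>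
    starInd a (v 0) (v 1) (v 2) (v 3) + 6 * pathInd a t (v 0) (v 1) (v 2) (v 3) with hF
  have hFv : ∀ (v : Fin 4 → V) (π : Equiv.Perm (Fin 4)), F (v ∘ π) = if Function.Injective v then
      (((isStar (fun i j => a (v i) (v j)) π).toNat
      + 6 * (isPath (fun i j => a (v i) (v j)) (t ∘ v) π).toNat : ℕ) : ℝ) else 0 := by
    intro v π
    have e : Function.Injective (v ∘ π) ↔ Function.Injective v :=
      Function.Injective.of_comp_iff' v π.bijective
    rw [← if_congr e rfl rfl, if_congr injective_fin_four rfl rfl]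
    have h2 := h ((v ∘ π) 0) ((v ∘ π) 2)
    have h3 := h ((v ∘ π) 1) ((v ∘ π) 3)
    simp only [hF, starInd, pathInd, isStar, isPath, Function.comp] at h2 h3 ⊢
    push_cast
    simp only [← ind_eq_toNat]
    generalize v (π 0) = p, v (π 1) = q, v (π 2) = r, v (π 3) = s at *
    have and_ind : ∀ b c : Bool, ind (b && c) = ind b * ind c := by
      intro b c; cases b <;> cases c <;> simp
    simp only [and_ind]
    by_cases hpq : p = q
    · subst hpq; simp [irr]; cases t p <;> simp
    by_cases hpr : p = r
    · subst hpr; simp [irr]; cases a p q <;> simp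
    by_cases hps : p = s
    · subst hps; simp [irr]
    by_cases hqr : q = r
    · subst hqr; simp [irr]
    by_cases hqs : q = s
    · subst hqs; simp; cases a p q <;> simp
    by_cases hrs : r = s
    · subst hrs; simp [irr]
    simp [hpq, hpr, hps, hqr, hqs, hrs]
  have h1 : 6 * quadCount a = ∑ v : Fin 4 → V, ∑ π : Equiv.Perm (Fin 4), F (v ∘ π) := by
    rw [quadCount, ← sum_fin_four, Finset.mul_sum]
    refine Finset.sum_congr rfl fun v _ => ?_
    rw [quadInd_eq_ite]
    simp only [hFv]
    by_cases hv : Function.Injective v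
    · simp only [hv, if_true, true_and]
      rw [← Nat.cast_sum, sum_star_path sym irr h]
      split_ifs <;> norm_num
    · simp [hv]
  rw [Finset.sum_comm] at h1
  have h2 : ∀ π : Equiv.Perm (Fin 4), ∑ v : Fin 4 → V, F (v ∘ π) = ∑ v, F v :=
    fun π => sum_comp_perm π F
  simp only [h2, Finset.sum_const, Finset.card_univ, Fintype.card_perm, Fintype.card_fin] at h1
  rw [hF, sum_fin_four (fun p q r s => starInd a p q r s + 6 * pathInd a t p q r s)] at h1
  simp only [Finset.sum_add_distrib, ← Finset.mul_sum] at h1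
  norm_num [Nat.factorial] at h1
  linarith

theorem sum_distinct_triple (u : V → Bool) :
    ∑ q, ∑ r, ∑ s, (if q ≠ r ∧ q ≠ s ∧ r ≠ s then ind (u q) * ind (u r) * ind (u s) else 0) =
      (∑ q, ind (u q)) * (∑ q, ind (u q) - 1) * (∑ q, ind (u q) - 2) := by
  have e : ∀ q r s, (if q ≠ r ∧ q ≠ s ∧ r ≠ s then ind (u q) * ind (u r) * ind (u s) else 0) =
      ind (u q) * ind (u r) * ind (u s) - (if q = r then ind (u q) * ind (u s) else 0)
        - (if q = s then ind (u q) * ind (u r) else 0) - (if r = s then ind (u q) * ind (u r) else 0)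
        + 2 * (if q = r then (if q = s then ind (u q) else 0) else 0) := by
    intro q r s
    by_cases h1 : q = r
    · subst h1
      by_cases h2 : q = s
      · subst h2; cases u q <;> norm_num
      · cases u q <;> cases u s <;> simp [h2]
    · by_cases h2 : q = s
      · subst h2; cases u q <;> cases u r <;> simp [h1, Ne.symm h1]
      · by_cases h3 : r = s
        · subst h3; cases u q <;> cases u r <;> simp [h1]
        · simp [h1, h2, h3]
  simp only [e, Finset.sum_add_distrib, Finset.sum_sub_distrib, ← Finset.mul_sum, ← Finset.sum_mul]
  have e1 : ∑ q, ∑ r, ∑ s, (if q = r then ind (u q) * ind (u s) else 0) = (∑ q, ind (u q)) ^ 2 := by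
    simp only [Finset.sum_ite_irrel, Finset.sum_const_zero, Finset.sum_ite_eq, Finset.mem_univ,
      if_true, sq, Finset.sum_mul_sum]
  have e2 : ∑ q, ∑ r, ∑ s, (if q = s then ind (u q) * ind (u r) else 0) = (∑ q, ind (u q)) ^ 2 := by
    simp only [Finset.sum_ite_eq, Finset.mem_univ, if_true, sq, Finset.sum_mul_sum]
  have e3 : ∑ q, ∑ r, ∑ s, (if r = s then ind (u q) * ind (u r) else 0) = (∑ q, ind (u q)) ^ 2 := by
    simp only [Finset.sum_ite_eq, Finset.mem_univ, if_true, sq, Finset.sum_mul_sum]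
  have e4 : ∑ q, ∑ r, ∑ s, (if q = r then (if q = s then ind (u q) else 0) else 0)
      = ∑ q, ind (u q) := by
    simp only [Finset.sum_ite_irrel, Finset.sum_const_zero, Finset.sum_ite_eq, Finset.mem_univ,
      if_true]
  rw [e1, e2, e3, e4]
  ring

/-- The degree of `p`. -/
def deg (a : V → V → Bool) (p : V) : ℝ := ∑ q, ind (a p q)

theorem sum_starInd (a : V → V → Bool) : ∑ p, ∑ q, ∑ r, ∑ s, starInd a p q r s =
    ∑ p, deg a p * (deg a p - 1) * (deg a p - 2) :=
  Finset.sum_congr rfl fun p _ => sum_distinct_triple (a p)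

/-- The number of vertices with `t = true`. -/
def side (t : V → Bool) : ℝ := ∑ x, ind (t x)

theorem side_add_side_not (t : V → Bool) :
    side t + side (fun x => !t x) = Fintype.card V := by
  simp only [side, ← Finset.sum_add_distrib, ind_not]
  simp

/-- The complete bipartite graph with sides `t = true` and `t = false`. -/
def bip (t : V → Bool) (x y : V) : Bool := t x ^^ t y

/-- The value of `quadCount` on a complete bipartite graph with sides of sizes `A` and `B`. -/
def starCount (A B : ℝ) : ℝ := 4 * (A * (B * (B - 1) * (B - 2)) + B * (A * (A - 1) * (A - 2)))

theorem quadCount_bip (t : V → Bool) :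
    quadCount (bip t) = starCount (side t) (side fun x => !t x) := by
  rw [quadCount_of_bipartite (a := bip t) (t := t) (fun x y => Bool.xor_comm _ _) (fun x => by simp [bip])
    (fun x y h => by simp [bip, h]), sum_starInd]
  have h1 : ∀ x y x' y', pathInd (bip t) t x y x' y' = 0 := by
    intro x y x' y'
    unfold pathInd bip
    cases t x <;> cases t y <;> simp
  have h2 : ∀ p, deg (bip t) p * (deg (bip t) p - 1) * (deg (bip t) p - 2) =
      ind (t p) * (side (fun x => !t x) * (side (fun x => !t x) - 1) * (side (fun x => !t x) - 2))
      + ind (!t p) * (side t * (side t - 1) * (side t - 2)) := by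
    intro p
    cases hp : t p <;> simp [deg, bip, side, hp]
  simp only [h1, h2, Finset.sum_add_distrib, ← Finset.sum_mul, Finset.sum_const_zero]
  unfold starCount side
  ring

/-- In terms of the squared difference `(A - B) ^ 2` of the sides, `starCount` is a downward parabola
with its top at `3 (A + B) - 4`. -/
theorem starCount_eq (A B : ℝ) : starCount A B =
    (((A + B) ^ 2 - (3 * (A + B) - 4)) ^ 2 - ((A - B) ^ 2 - (3 * (A + B) - 4)) ^ 2) / 2 := by
  unfold starCount
  ring

end

/-! ### Replacing the neighbourhood of a vertex -/

section

variable {V : Type*} [Fintype V] [DecidableEq V]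

/-- The graph obtained from `a` by replacing the neighbourhood of `v` by `S`. -/
def replaceNbhd (a : V → V → Bool) (v : V) (S : V → Bool) (x y : V) : Bool :=
  if x = v then (!decide (y = v) && S y) else if y = v then S x else a x y

/-- Indicator that `v, q, r, s` are distinct and span three edges if the neighbourhood of `v` is replaced
by `S`. -/
def linkInd (a : V → V → Bool) (v : V) (S : V → Bool) (q r s : V) : ℝ :=
  if v ≠ q ∧ v ≠ r ∧ v ≠ s ∧ q ≠ r ∧ q ≠ s ∧ r ≠ s ∧
    (S q).toNat + (S r).toNat + (S s).toNat + (a q r).toNat + (a q s).toNat + (a r s).toNat = 3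
  then 1 else 0

/-- The number of ordered triples that form a counted quadruple with `v` if its neighbourhood is `S`. -/
def linkCount (a : V → V → Bool) (v : V) (S : V → Bool) : ℝ :=
  ∑ q, ∑ r, ∑ s, linkInd a v S q r s

theorem replaceNbhd_symm {a : V → V → Bool} (sym : ∀ x y, a x y = a y x) (v : V) (S : V → Bool)
    (x y : V) : replaceNbhd a v S x y = replaceNbhd a v S y x := by
  unfold replaceNbhd
  by_cases h1 : x = v <;> by_cases h2 : y = v <;> simp [h1, h2, sym x y]

theorem replaceNbhd_irrefl {a : V → V → Bool} (irr : ∀ x, a x x = false) (v : V) (S : V → Bool)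
    (x : V) : replaceNbhd a v S x x = false := by
  unfold replaceNbhd
  by_cases h1 : x = v <;> simp [h1, irr]

theorem quadInd_swap₁ {a : V → V → Bool} (sym : ∀ x y, a x y = a y x) (p q r s : V) :
    quadInd a q p r s = quadInd a p q r s := by
  unfold quadInd edgeSum
  refine if_congr ?_ rfl rfl
  rw [sym q p]
  grind

theorem quadInd_swap₂ {a : V → V → Bool} (sym : ∀ x y, a x y = a y x) (p q r s : V) :
    quadInd a r q p s = quadInd a p q r s := by
  unfold quadInd edgeSum
  refine if_congr ?_ rfl rfl
  rw [sym r q, sym r p, sym q p]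
  grind

theorem quadInd_swap₃ {a : V → V → Bool} (sym : ∀ x y, a x y = a y x) (p q r s : V) :
    quadInd a s q r p = quadInd a p q r s := by
  unfold quadInd edgeSum
  refine if_congr ?_ rfl rfl
  rw [sym s q, sym s r, sym s p, sym r p, sym q p]
  grind

theorem quadInd_replaceNbhd_self (a : V → V → Bool) (v : V) (S : V → Bool) (q r s : V) :
    quadInd (replaceNbhd a v S) v q r s = linkInd a v S q r s := by
  unfold quadInd linkInd edgeSum replaceNbhd
  refine if_congr ?_ rfl rfl
  by_cases h1 : v = q
  · simp [h1]
  by_cases h2 : v = r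
  · simp [h2]
  by_cases h3 : v = s
  · simp [h3]
  simp [h1, h2, h3, Ne.symm h1, Ne.symm h2, Ne.symm h3]

theorem quadInd_replaceNbhd_of_ne (a : V → V → Bool) (v : V) (S : V → Bool) {p q r s : V}
    (hp : p ≠ v) (hq : q ≠ v) (hr : r ≠ v) (hs : s ≠ v) :
    quadInd (replaceNbhd a v S) p q r s = quadInd a p q r s := by
  unfold quadInd edgeSum replaceNbhd
  simp [hp, hq, hr, hs]

theorem linkInd_self (a : V → V → Bool) (v : V) (q r s : V) :
    linkInd a v (a v) q r s = quadInd a v q r s := rfl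

/-- Each counted quadruple through `v` has `v` in one of four positions. -/
theorem quadCount_replaceNbhd {a : V → V → Bool} (sym : ∀ x y, a x y = a y x) (v : V)
    (S : V → Bool) :
    quadCount (replaceNbhd a v S) - quadCount a =
      4 * (linkCount a v S - linkCount a v (a v)) := by
  have sym' := replaceNbhd_symm sym v S
  set Δ : V → V → V → V → ℝ := fun p q r s =>
    quadInd (replaceNbhd a v S) p q r s - quadInd a p q r s with hΔ
  have d1 : ∀ p q r s, Δ q p r s = Δ p q r s := fun p q r s => by
    simp only [hΔ, quadInd_swap₁ sym p q, quadInd_swap₁ sym' p q]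
  have d2 : ∀ p q r s, Δ r q p s = Δ p q r s := fun p q r s => by
    simp only [hΔ, quadInd_swap₂ sym p q, quadInd_swap₂ sym' p q]
  have d3 : ∀ p q r s, Δ s q r p = Δ p q r s := fun p q r s => by
    simp only [hΔ, quadInd_swap₃ sym p q, quadInd_swap₃ sym' p q]
  have z : ∀ p q r s, ¬ (p ≠ q ∧ p ≠ r ∧ p ≠ s ∧ q ≠ r ∧ q ≠ s ∧ r ≠ s) → Δ p q r s = 0 := by
    intro p q r s h
    simp only [hΔ, quadInd]
    rw [if_neg (by tauto), if_neg (by tauto), sub_zero]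
  have split : ∀ p q r s, Δ p q r s = (if p = v then Δ p q r s else 0)
      + (if q = v then Δ p q r s else 0) + (if r = v then Δ p q r s else 0)
      + (if s = v then Δ p q r s else 0) := by
    intro p q r s
    by_cases hd : p ≠ q ∧ p ≠ r ∧ p ≠ s ∧ q ≠ r ∧ q ≠ s ∧ r ≠ s
    · by_cases hp : p = v
      · simp [← hp, hd.1.symm, hd.2.1.symm, hd.2.2.1.symm]
      by_cases hq : q = v
      · simp [← hq, hd.1, hd.2.2.2.1.symm, hd.2.2.2.2.1.symm]
      by_cases hr : r = v
      · simp [← hr, hd.2.1, hd.2.2.2.1, hd.2.2.2.2.2.symm]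
      by_cases hs : s = v
      · simp [← hs, hd.2.2.1, hd.2.2.2.2.1, hd.2.2.2.2.2]
      simp only [hΔ, quadInd_replaceNbhd_of_ne a v S hp hq hr hs]
      simp
    · simp [z p q r s hd]
  have s1 : ∑ p, ∑ q, ∑ r, ∑ s, (if p = v then Δ p q r s else 0) = ∑ q, ∑ r, ∑ s, Δ v q r s := by
    simp only [Finset.sum_ite_irrel, Finset.sum_const_zero, Finset.sum_ite_eq', Finset.mem_univ,
      if_true]
  have s2 : ∑ p, ∑ q, ∑ r, ∑ s, (if q = v then Δ p q r s else 0) = ∑ q, ∑ r, ∑ s, Δ v q r s := by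
    simp only [Finset.sum_ite_irrel, Finset.sum_const_zero, Finset.sum_ite_eq', Finset.mem_univ,
      if_true, d1 v]
  have s3 : ∑ p, ∑ q, ∑ r, ∑ s, (if r = v then Δ p q r s else 0) = ∑ q, ∑ r, ∑ s, Δ v q r s := by
    simp only [Finset.sum_ite_irrel, Finset.sum_const_zero, Finset.sum_ite_eq', Finset.mem_univ,
      if_true, d2 v]
    exact Finset.sum_comm
  have s4 : ∑ p, ∑ q, ∑ r, ∑ s, (if s = v then Δ p q r s else 0) = ∑ q, ∑ r, ∑ s, Δ v q r s := by
    simp only [Finset.sum_ite_eq', Finset.mem_univ, if_true, d3 v]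
    rw [Finset.sum_comm]
    refine Finset.sum_congr rfl fun q _ => Finset.sum_comm
  have e1 : quadCount (replaceNbhd a v S) - quadCount a = ∑ p, ∑ q, ∑ r, ∑ s, Δ p q r s := by
    simp only [quadCount, hΔ, Finset.sum_sub_distrib]
  have e2 : linkCount a v S - linkCount a v (a v) = ∑ q, ∑ r, ∑ s, Δ v q r s := by
    simp only [linkCount, hΔ, Finset.sum_sub_distrib, quadInd_replaceNbhd_self, linkInd_self]
  rw [e1, e2, Finset.sum_congr rfl fun p _ => Finset.sum_congr rfl fun q _ =>
    Finset.sum_congr rfl fun r _ => Finset.sum_congr rfl fun s _ => split p q r s]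
  simp only [Finset.sum_add_distrib, s1, s2, s3, s4]
  ring

/-- `a` maximizes `quadCount` among the adjacency functions of graphs on `V`. -/
def IsExtremal (a : V → V → Bool) : Prop :=
  ∀ a' : V → V → Bool, (∀ x y, a' x y = a' y x) → (∀ x, a' x x = false) →
    quadCount a' ≤ quadCount a

theorem IsExtremal.linkCount_le {a : V → V → Bool} (sym : ∀ x y, a x y = a y x)
    (irr : ∀ x, a x x = false) (h : IsExtremal a) (v : V) (S : V → Bool) :
    linkCount a v S ≤ linkCount a v (a v) := by
  have h1 := quadCount_replaceNbhd sym v S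
  have h2 := h _ (replaceNbhd_symm sym v S) (replaceNbhd_irrefl irr v S)
  linarith

/-- Indicator that the adjacency of `x` and `y` in `a` differs from that in `bip t`. -/
def wrong (a : V → V → Bool) (t : V → Bool) (x y : V) : ℝ := ind (a x y ^^ bip t x y)

theorem wrong_nonneg (a : V → V → Bool) (t : V → Bool) (x y : V) : 0 ≤ wrong a t x y :=
  ind_nonneg _

theorem sum_wrong (a : V → V → Bool) (t : V → Bool) :
    ∑ x, ∑ y, wrong a t x y = discrepancy a t := by
  rw [discrepancy, ← Finset.sum_boole, Fintype.sum_prod_type]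
  refine Finset.sum_congr rfl fun x _ => Finset.sum_congr rfl fun y _ => ?_
  unfold wrong bip
  cases a x y <;> cases t x <;> cases t y <;> simp

theorem wrong_eq_zero {a : V → V → Bool} {t : V → Bool} {x y : V} (h : wrong a t x y ≠ 1) :
    a x y = bip t x y := by
  unfold wrong at h
  revert h
  cases a x y <;> cases bip t x y <;> simp

/-- An upper bound that does not exclude repeated vertices: each pair on which `a` differs from `bip t`
spoils at most `6 n ^ 2` quadruples, and `bip t` has three edges on quadruples that are split as
`1 + 3`. -/
theorem quadCount_le_bip (a : V → V → Bool) (t : V → Bool) :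
    quadCount a ≤ 4 * (side t * side (fun x => !t x)) *
      (side t ^ 2 + side (fun x => !t x) ^ 2) +
      6 * discrepancy a t * (Fintype.card V : ℝ) ^ 2 := by
  set J : V → V → V → V → ℝ := fun p q r s =>
    ind (t p) * ind (!t q) * ind (!t r) * ind (!t s) + ind (!t p) * ind (t q) * ind (t r) * ind (t s)
    with hJ
  have h : ∀ p q r s, quadInd a p q r s ≤ J p q r s + J q p r s + J r p q s + J s p q r +
      (wrong a t p q + wrong a t p r + wrong a t p s + wrong a t q r + wrong a t q s
        + wrong a t r s) := by
    intro p q r s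
    have hJ0 : ∀ p q r s, 0 ≤ J p q r s := fun p q r s => by
      have := ind_nonneg
      simp only [hJ]
      exact add_nonneg (mul_nonneg (mul_nonneg (mul_nonneg (this _) (this _)) (this _)) (this _))
        (mul_nonneg (mul_nonneg (mul_nonneg (this _) (this _)) (this _)) (this _))
    have w0 := wrong_nonneg a t
    have q1 : quadInd a p q r s ≤ 1 := by unfold quadInd; split_ifs <;> norm_num
    have := hJ0 p q r s; have := hJ0 q p r s; have := hJ0 r p q s; have := hJ0 s p q r
    have := w0 p q; have := w0 p r; have := w0 p s; have := w0 q r; have := w0 q s; have := w0 r s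
    by_cases h1 : wrong a t p q = 1
    · linarith
    by_cases h2 : wrong a t p r = 1
    · linarith
    by_cases h3 : wrong a t p s = 1
    · linarith
    by_cases h4 : wrong a t q r = 1
    · linarith
    by_cases h5 : wrong a t q s = 1
    · linarith
    by_cases h6 : wrong a t r s = 1
    · linarith
    have key : quadInd a p q r s ≤ J p q r s + J q p r s + J r p q s + J s p q r := by
      unfold quadInd
      split_ifs with h
      · replace h := h.2.2.2.2.2.2
        revert h
        unfold edgeSum
        rw [wrong_eq_zero h1, wrong_eq_zero h2, wrong_eq_zero h3, wrong_eq_zero h4,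
          wrong_eq_zero h5, wrong_eq_zero h6]
        simp only [hJ, bip]
        cases t p <;> cases t q <;> cases t r <;> cases t s <;> simp
      · linarith [hJ0 p q r s]
    linarith
  have h1 : quadCount a ≤ _ := Finset.sum_le_sum fun p _ => Finset.sum_le_sum fun q _ =>
    Finset.sum_le_sum fun r _ => Finset.sum_le_sum fun s _ => h p q r s
  refine h1.trans (le_of_eq ?_)
  simp only [hJ, Finset.sum_add_distrib, ← Finset.mul_sum, ← Finset.sum_mul, Finset.sum_const,
    Finset.card_univ, nsmul_eq_mul, sum_wrong]
  unfold side
  ring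

end

/-! ### Every vertex of an extremal graph respects the bipartition -/

section

variable {V : Type*} [Fintype V] [DecidableEq V]

/-- `linkInd` for the complete bipartite graph with sides `t`, without the condition that the vertices
be distinct. -/
def bipLinkInd (t S : V → Bool) (q r s : V) : ℝ :=
  if (S q).toNat + (S r).toNat + (S s).toNat + (bip t q r).toNat + (bip t q s).toNat
    + (bip t r s).toNat = 3 then 1 else 0

/-- The sum of `bipLinkInd` over all triples. -/
def bipLinkCount (t S : V → Bool) : ℝ := ∑ q, ∑ r, ∑ s, bipLinkInd t S q r s

theorem linkInd_le (a : V → V → Bool) (v : V) (t S : V → Bool) (q r s : V) :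
    linkInd a v S q r s ≤ bipLinkInd t S q r s +
      (wrong a t q r + wrong a t q s + wrong a t r s) := by
  have w0 := wrong_nonneg a t
  have := w0 q r; have := w0 q s; have := w0 r s
  have b0 : 0 ≤ bipLinkInd t S q r s := by unfold bipLinkInd; split_ifs <;> norm_num
  have l1 : linkInd a v S q r s ≤ 1 := by unfold linkInd; split_ifs <;> norm_num
  by_cases h1 : wrong a t q r = 1
  · linarith
  by_cases h2 : wrong a t q s = 1
  · linarith
  by_cases h3 : wrong a t r s = 1
  · linarith
  have : linkInd a v S q r s ≤ bipLinkInd t S q r s := by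
    unfold linkInd
    split_ifs with h
    · have h := h.2.2.2.2.2.2
      rw [wrong_eq_zero h1, wrong_eq_zero h2, wrong_eq_zero h3] at h
      unfold bipLinkInd
      rw [if_pos h]
    · exact b0
  linarith

theorem bipLinkInd_le (a : V → V → Bool) (v : V) (t S : V → Bool) (q r s : V) :
    bipLinkInd t S q r s ≤ linkInd a v S q r s +
      (wrong a t q r + wrong a t q s + wrong a t r s) + ((if v = q then 1 else 0)
      + (if v = r then 1 else 0) + (if v = s then 1 else 0) + (if q = r then 1 else 0)
      + (if q = s then 1 else 0) + (if r = s then 1 else 0)) := by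
  have w0 := wrong_nonneg a t
  have := w0 q r; have := w0 q s; have := w0 r s
  have b1 : bipLinkInd t S q r s ≤ 1 := by unfold bipLinkInd; split_ifs <;> norm_num
  have l0 : 0 ≤ linkInd a v S q r s := by unfold linkInd; split_ifs <;> norm_num
  have i0 : ∀ p : Prop, [Decidable p] → (0 : ℝ) ≤ if p then 1 else 0 := by
    intro p _; split_ifs <;> norm_num
  have j1 := i0 (v = q); have j2 := i0 (v = r); have j3 := i0 (v = s)
  have j4 := i0 (q = r); have j5 := i0 (q = s); have j6 := i0 (r = s)
  by_cases h1 : wrong a t q r = 1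
  · linarith
  by_cases h2 : wrong a t q s = 1
  · linarith
  by_cases h3 : wrong a t r s = 1
  · linarith
  by_cases h : v ≠ q ∧ v ≠ r ∧ v ≠ s ∧ q ≠ r ∧ q ≠ s ∧ r ≠ s
  · have : bipLinkInd t S q r s ≤ linkInd a v S q r s := by
      unfold bipLinkInd
      split_ifs with hb
      · rw [← wrong_eq_zero h1, ← wrong_eq_zero h2, ← wrong_eq_zero h3] at hb
        unfold linkInd
        rw [if_pos ⟨h.1, h.2.1, h.2.2.1, h.2.2.2.1, h.2.2.2.2.1, h.2.2.2.2.2, hb⟩]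
      · exact l0
    linarith
  · have : (1 : ℝ) ≤ (if v = q then 1 else 0)
        + (if v = r then 1 else 0) + (if v = s then 1 else 0) + (if q = r then 1 else 0)
        + (if q = s then 1 else 0) + (if r = s then 1 else 0) := by
      by_contra hlt
      refine h ⟨?_, ?_, ?_, ?_, ?_, ?_⟩ <;> intro heq <;> rw [if_pos heq] at hlt <;>
        exact hlt (by linarith)
    linarith

theorem linkCount_le_bipLinkCount (a : V → V → Bool) (v : V) (t S : V → Bool) :
    linkCount a v S ≤ bipLinkCount t S + 3 * discrepancy a t * Fintype.card V := by
  have h : linkCount a v S ≤ _ := Finset.sum_le_sum fun q _ => Finset.sum_le_sum fun r _ =>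
    Finset.sum_le_sum fun s _ => linkInd_le a v t S q r s
  refine h.trans (le_of_eq ?_)
  simp only [Finset.sum_add_distrib, ← Finset.mul_sum, Finset.sum_const, Finset.card_univ,
    nsmul_eq_mul, sum_wrong, bipLinkCount]
  ring

theorem bipLinkCount_le_linkCount (a : V → V → Bool) (v : V) (t S : V → Bool) :
    bipLinkCount t S ≤ linkCount a v S + 3 * discrepancy a t * Fintype.card V
      + 6 * (Fintype.card V : ℝ) ^ 2 := by
  have h : bipLinkCount t S ≤ _ := Finset.sum_le_sum fun q _ => Finset.sum_le_sum fun r _ =>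
    Finset.sum_le_sum fun s _ => bipLinkInd_le a v t S q r s
  refine h.trans (le_of_eq ?_)
  simp only [Finset.sum_add_distrib, ← Finset.mul_sum, Finset.sum_const, Finset.card_univ,
    nsmul_eq_mul, sum_wrong, linkCount, Finset.sum_ite_eq, Finset.mem_univ, if_true]
  ring

/-- `bipLinkCount` in terms of the sizes `A`, `B` of the two sides and the sizes `α`, `β` of the
parts of the neighbourhood in them. -/
def linkPoly (A B α β : ℝ) : ℝ :=
  α ^ 3 + β ^ 3
    + 3 * ((α + β) * (A + B - (α + β)) ^ 2 - α * (A - α) ^ 2 - β * (B - β) ^ 2)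

theorem bipLinkCount_eq (t S : V → Bool) : bipLinkCount t S = linkPoly (side t)
    (side fun x => !t x) (side fun x => S x && t x) (side fun x => S x && !t x) := by
  set i : V → ℝ := fun x => ind (S x && t x) with hi
  set j : V → ℝ := fun x => ind (S x && !t x) with hj
  set c : V → ℝ := fun x => ind (t x) with hc
  set d : V → ℝ := fun x => ind (!t x) with hd
  have h : ∀ q r s, bipLinkInd t S q r s = i q * i r * i s + j q * j r * j s
      + ((i q + j q) * (c r + d r - (i r + j r)) * (c s + d s - (i s + j s))
        - i q * (c r - i r) * (c s - i s) - j q * (d r - j r) * (d s - j s))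
      + ((c q + d q - (i q + j q)) * (i r + j r) * (c s + d s - (i s + j s))
        - (c q - i q) * i r * (c s - i s) - (d q - j q) * j r * (d s - j s))
      + ((c q + d q - (i q + j q)) * (c r + d r - (i r + j r)) * (i s + j s)
        - (c q - i q) * (c r - i r) * i s - (d q - j q) * (d r - j r) * j s) := by
    intro q r s
    unfold bipLinkInd
    split_ifs with hb <;> revert hb <;> simp only [bip, hi, hj, hc, hd] <;>
      cases S q <;> cases S r <;> cases S s <;> cases t q <;> cases t r <;> cases t s <;>
      norm_num
  simp only [bipLinkCount, h, Finset.sum_add_distrib, Finset.sum_sub_distrib, ← Finset.mul_sum,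
    ← Finset.sum_mul]
  unfold linkPoly side
  ring

/-- If a neighbourhood that meets the two sides in `α` and `β` vertices is almost as good as the whole
second side, then it is close to the second side. The first side is excluded by `hD`. -/
theorem linkPoly_stability {A B α β : ℝ} (hα : 0 ≤ α) (hβ : 0 ≤ β) (hαA : α ≤ A) (hβB : β ≤ B)
    (hD : α + (B - β) ≤ (A + B) / 2) (hAB : |A - B| ≤ (A + B) / 100000)
    (h : linkPoly A B 0 B ≤ linkPoly A B α β + (A + B) ^ 3 / 80000) :
    α + (B - β) ≤ (A + B) / 100 := by
  obtain ⟨N, hN⟩ : ∃ N, N = (A + B) / 2 := ⟨_, rfl⟩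
  obtain ⟨d, hd⟩ : ∃ d, d = (A - B) / 2 := ⟨_, rfl⟩
  obtain ⟨σ, hσ⟩ : ∃ σ, σ = α + β := ⟨_, rfl⟩
  have hA : A = N + d := by rw [hN, hd]; ring
  have hB : B = N - d := by rw [hN, hd]; ring
  have hN0 : 0 ≤ N := by rw [hN]; linarith
  have hdN : |d| ≤ N / 100000 := by
    have : A - B = 2 * d := by rw [hd]; ring
    rw [this, abs_mul, abs_two] at hAB
    linarith
  obtain ⟨d1, d2⟩ := abs_le.1 hdN
  rcases hN0.eq_or_lt with h0 | hNpos
  · linarith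
  have hσ2 : σ ≤ 2 * N := by linarith
  have hσ0 : 0 ≤ σ := by linarith
  -- The defect of `linkPoly`, with the symmetric part isolated.
  have id : linkPoly A B 0 B - linkPoly A B α β =
      (4 * N - σ) * (N - σ) ^ 2 + 6 * (α * β) * (2 * N - σ) - 4 * d ^ 3
        - 6 * (d * ((α - β) * (σ - N))) + 3 * (d ^ 2 * σ) := by
    rw [hA, hB, hσ]
    unfold linkPoly
    ring
  have e1 : |d * ((α - β) * (σ - N))| ≤ N / 100000 * (2 * N * N) := by
    rw [abs_mul, abs_mul]
    gcongr
    · exact abs_le.2 ⟨by linarith, by linarith⟩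
    · exact abs_le.2 ⟨by linarith, by linarith⟩
  have e2 : d ^ 3 ≤ N / 100000 * (N * N) := by
    have : |d ^ 3| ≤ N / 100000 * (N * N) := by
      rw [show d ^ 3 = d * (d * d) by ring, abs_mul, abs_mul]
      gcongr <;> linarith
    exact (le_abs_self _).trans this
  have e3 := (abs_le.1 e1).2
  have e4 : 0 ≤ d ^ 2 * σ := by positivity
  have main : (4 * N - σ) * (N - σ) ^ 2 + 6 * (α * β) * (2 * N - σ) ≤ 3 / 10000 * N ^ 3 := by
    have : (A + B) ^ 3 / 80000 = N ^ 3 / 10000 := by rw [hA, hB]; ring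
    linarith [pow_pos hNpos 3]
  have hαβ : 0 ≤ α * β := mul_nonneg hα hβ
  have f1 : (N - σ) ^ 2 ≤ (N / 80) ^ 2 := by
    have g1 : 0 ≤ 6 * (α * β) * (2 * N - σ) := mul_nonneg (by positivity) (by linarith)
    have g2 : 2 * N * (N - σ) ^ 2 ≤ (4 * N - σ) * (N - σ) ^ 2 :=
      mul_le_mul_of_nonneg_right (by linarith) (sq_nonneg _)
    have g3 : 2 * N * (N - σ) ^ 2 ≤ 2 * N * (N / 80) ^ 2 := by linarith [pow_pos hNpos 3]
    exact le_of_mul_le_mul_left g3 (by linarith)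
  have f2 := abs_le_of_sq_le_sq' f1 (by linarith)
  have f3 : α * β ≤ N ^ 2 / 15000 := by
    have g1 : 0 ≤ (4 * N - σ) * (N - σ) ^ 2 := mul_nonneg (by linarith) (sq_nonneg _)
    have g2 : 5 * N * (α * β) ≤ 6 * (α * β) * (2 * N - σ) := by
      have := mul_le_mul_of_nonneg_left (show 5 * N ≤ 6 * (2 * N - σ) by linarith [f2.1]) hαβ
      linarith
    have g3 : 5 * N * (α * β) ≤ 5 * N * (N ^ 2 / 15000) := by linarith [pow_pos hNpos 3]
    exact le_of_mul_le_mul_left g3 (by linarith)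
  have f4 : 49 / 100 * N ≤ β := by linarith [f2.2]
  have f5 : α ≤ N / 1000 := by
    have : 49 / 100 * N * α ≤ 49 / 100 * N * (N / 1000) := by
      have := mul_le_mul_of_nonneg_right f4 hα
      linarith [sq_nonneg N]
    exact le_of_mul_le_mul_left this (by linarith)
  linarith [f2.2]

theorem sum_wrong_true (a : V → V → Bool) {t : V → Bool} {v : V} (hv : t v = true) :
    ∑ y, wrong a t v y = side (fun x => a v x && t x)
      + (side (fun x => !t x) - side fun x => a v x && !t x) := by
  simp only [side, ← Finset.sum_sub_distrib, ← Finset.sum_add_distrib]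
  refine Finset.sum_congr rfl fun y _ => ?_
  simp only [wrong, bip, hv]
  cases a v y <;> cases t y <;> simp

theorem wrong_not (a : V → V → Bool) (t : V → Bool) : wrong a (fun x => !t x) = wrong a t := by
  funext x y
  simp only [wrong, bip]
  cases t x <;> cases t y <;> rfl

theorem discrepancy_not (a : V → V → Bool) (t : V → Bool) :
    (discrepancy a (fun x => !t x) : ℝ) = discrepancy a t := by
  rw [← sum_wrong, ← sum_wrong, wrong_not]

theorem side_nonneg (t : V → Bool) : 0 ≤ side t := Finset.sum_nonneg fun _ _ => ind_nonneg _

theorem side_le_side {t u : V → Bool} (h : ∀ x, t x = true → u x = true) : side t ≤ side u := by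
  refine Finset.sum_le_sum fun x _ => ?_
  have := h x
  cases ht : t x
  · simp [ind_nonneg]
  · simp [this ht]

theorem side_and_self (t : V → Bool) : side (fun x => t x && t x) = side t := by
  simp [side]

theorem side_not_and_self (t : V → Bool) : side (fun x => !t x && t x) = 0 := by
  simp [side]

/-- Replacing the neighbourhood of `v` by the opposite side cannot improve an extremal graph; by
`linkPoly_stability` the neighbourhood is then close to the opposite side. -/
theorem sum_wrong_le_of_true {a : V → V → Bool} (sym : ∀ x y, a x y = a y x)
    (irr : ∀ x, a x x = false) (hext : IsExtremal a) {t : V → Bool} {v : V}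
    (hhalf : ∑ y, wrong a t v y ≤ (Fintype.card V : ℝ) / 2)
    (hbal : |side t - side fun x => !t x| ≤ (Fintype.card V : ℝ) / 100000)
    (herr : 6 * discrepancy a t * (Fintype.card V : ℝ) + 6 * (Fintype.card V : ℝ) ^ 2
      ≤ (Fintype.card V : ℝ) ^ 3 / 80000) (hv : t v = true) :
    ∑ y, wrong a t v y ≤ (Fintype.card V : ℝ) / 100 := by
  have h1 := hext.linkCount_le sym irr v fun x => !t x
  have h2 := linkCount_le_bipLinkCount a v t (a v)
  have h3 := bipLinkCount_le_linkCount a v t fun x => !t x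
  rw [bipLinkCount_eq] at h2 h3
  rw [side_not_and_self, side_and_self fun x => !t x] at h3
  rw [sum_wrong_true a hv] at hhalf ⊢
  rw [← side_add_side_not t] at hhalf hbal ⊢
  refine linkPoly_stability (side_nonneg _) (side_nonneg _) (side_le_side ?_) (side_le_side ?_)
    hhalf hbal ?_
  · simp
  · simp
  · rw [side_add_side_not t]
    linarith

theorem sum_wrong_le {a : V → V → Bool} (sym : ∀ x y, a x y = a y x)
    (irr : ∀ x, a x x = false) (hext : IsExtremal a) {t : V → Bool} {v : V}
    (hhalf : ∑ y, wrong a t v y ≤ (Fintype.card V : ℝ) / 2)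
    (hbal : |side t - side fun x => !t x| ≤ (Fintype.card V : ℝ) / 100000)
    (herr : 6 * discrepancy a t * (Fintype.card V : ℝ) + 6 * (Fintype.card V : ℝ) ^ 2
      ≤ (Fintype.card V : ℝ) ^ 3 / 80000) :
    ∑ y, wrong a t v y ≤ (Fintype.card V : ℝ) / 100 := by
  cases hv : t v
  · have := sum_wrong_le_of_true sym irr hext (t := fun x => !t x) (v := v)
    rw [wrong_not, discrepancy_not] at this
    refine this hhalf ?_ herr (by simp [hv])
    simp only [Bool.not_not]
    rwa [abs_sub_comm]
  · exact sum_wrong_le_of_true sym irr hext hhalf hbal herr hv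

/-- If `t` minimizes the discrepancy, moving `v` to the other side does not lower it, so at most half of
the pairs at `v` are wrong. -/
theorem sum_wrong_le_half {a : V → V → Bool} (sym : ∀ x y, a x y = a y x)
    (irr : ∀ x, a x x = false) {t : V → Bool}
    (hmin : ∀ u : V → Bool, discrepancy a t ≤ discrepancy a u) (v : V) :
    ∑ y, wrong a t v y ≤ (Fintype.card V : ℝ) / 2 := by
  have wsym : ∀ x y, wrong a t x y = wrong a t y x := fun x y => by
    unfold wrong bip
    rw [sym x y, Bool.xor_comm (t x)]
  set u : V → Bool := Function.update t v (!t v) with hu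
  have h : ∀ x y, wrong a u x y = wrong a t x y + (if v = x then 1 - 2 * wrong a t v y else 0)
      + (if v = y then 1 - 2 * wrong a t v x else 0)
      - 2 * (if v = x then (if v = y then 1 else 0) else 0) := by
    intro x y
    by_cases hx : v = x
    · subst hx
      by_cases hy : v = y
      · subst hy
        simp [wrong, bip, irr]
        norm_num
      · simp only [hy, if_true, if_false, wrong, bip, hu, Function.update_self,
          Function.update_of_ne (Ne.symm hy)]
        cases a v y <;> cases t v <;> cases t y <;> norm_num
    · by_cases hy : v = y
      · subst hy
        simp only [hx, if_true, if_false, wrong, bip, hu, Function.update_self,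
          Function.update_of_ne (Ne.symm hx), sym v x]
        cases a x v <;> cases t v <;> cases t x <;> norm_num
      · simp [hx, hy, wrong, bip, hu, Function.update_of_ne (Ne.symm hx),
          Function.update_of_ne (Ne.symm hy)]
  have h1 : (discrepancy a u : ℝ) = discrepancy a t
      + 2 * (Fintype.card V - 2 * ∑ y, wrong a t v y) - 2 := by
    rw [← sum_wrong, ← sum_wrong]
    simp only [h, Finset.sum_add_distrib, Finset.sum_sub_distrib, ← Finset.mul_sum,
      Finset.sum_ite_irrel, Finset.sum_const_zero, Finset.sum_ite_eq, Finset.mem_univ, if_true,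
      Finset.sum_const, Finset.card_univ, nsmul_eq_mul]
    ring
  have h2 : (discrepancy a t : ℝ) ≤ discrepancy a u := Nat.cast_le.2 (hmin u)
  linarith

end

/-! ### No edges inside the sides -/

section

variable {V : Type*} [Fintype V] [DecidableEq V]

theorem linkInd_swap₁ {a : V → V → Bool} (sym : ∀ x y, a x y = a y x) (v : V) (S : V → Bool)
    (q r s : V) : linkInd a v S r q s = linkInd a v S q r s := by
  unfold linkInd
  refine if_congr ?_ rfl rfl
  rw [sym r q]
  grind

theorem linkInd_swap₂ {a : V → V → Bool} (sym : ∀ x y, a x y = a y x) (v : V) (S : V → Bool)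
    (q r s : V) : linkInd a v S s r q = linkInd a v S q r s := by
  unfold linkInd
  refine if_congr ?_ rfl rfl
  rw [sym s q, sym s r, sym r q]
  grind

/-- Changing the adjacency of `x` and `v` affects only triples that contain `x`. -/
theorem linkCount_sub_update {a : V → V → Bool} (sym : ∀ x y, a x y = a y x) (v x : V)
    (S : V → Bool) (b : Bool) :
    linkCount a v S - linkCount a v (Function.update S x b) =
      3 * ∑ z, ∑ w, (linkInd a v S x z w - linkInd a v (Function.update S x b) x z w) := by
  set L : V → V → V → ℝ := fun q r s =>
    linkInd a v S q r s - linkInd a v (Function.update S x b) q r s with hL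
  have d1 : ∀ q r s, L r q s = L q r s := fun q r s => by
    simp only [hL, linkInd_swap₁ sym v _ q]
  have d2 : ∀ q r s, L s r q = L q r s := fun q r s => by
    simp only [hL, linkInd_swap₂ sym v _ q]
  have z : ∀ q r s, ¬ (q ≠ r ∧ q ≠ s ∧ r ≠ s) → L q r s = 0 := by
    intro q r s h
    simp only [hL, linkInd]
    rw [if_neg (by tauto), if_neg (by tauto), sub_zero]
  have split : ∀ q r s, L q r s = (if q = x then L q r s else 0)
      + (if r = x then L q r s else 0) + (if s = x then L q r s else 0) := by
    intro q r s
    by_cases hd : q ≠ r ∧ q ≠ s ∧ r ≠ s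
    · by_cases hq : q = x
      · simp [← hq, hd.1.symm, hd.2.1.symm]
      by_cases hr : r = x
      · simp [← hr, hd.1, hd.2.2.symm]
      by_cases hs : s = x
      · simp [← hs, hd.2.1, hd.2.2]
      simp [hL, linkInd, hq, hr, hs]
    · simp [z q r s hd]
  have s1 : ∑ q, ∑ r, ∑ s, (if q = x then L q r s else 0) = ∑ z, ∑ w, L x z w := by
    simp only [Finset.sum_ite_irrel, Finset.sum_const_zero, Finset.sum_ite_eq', Finset.mem_univ,
      if_true]
  have s2 : ∑ q, ∑ r, ∑ s, (if r = x then L q r s else 0) = ∑ z, ∑ w, L x z w := by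
    simp only [Finset.sum_ite_irrel, Finset.sum_const_zero, Finset.sum_ite_eq', Finset.mem_univ,
      if_true, d1 x]
  have s3 : ∑ q, ∑ r, ∑ s, (if s = x then L q r s else 0) = ∑ z, ∑ w, L x z w := by
    simp only [Finset.sum_ite_eq', Finset.mem_univ, if_true, d2 x]
    exact Finset.sum_comm
  have e1 : linkCount a v S - linkCount a v (Function.update S x b)
      = ∑ q, ∑ r, ∑ s, L q r s := by
    simp only [linkCount, hL, Finset.sum_sub_distrib]
  rw [e1, Finset.sum_congr rfl fun q _ => Finset.sum_congr rfl fun r _ =>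
    Finset.sum_congr rfl fun s _ => split q r s]
  simp only [Finset.sum_add_distrib, s1, s2, s3]
  ring

/-- The effect of an edge `vx` inside a side. If all other pairs follow the bipartition, then deleting
the edge gains the quadruples `v, x, z, w` with `z`, `w` on different sides: these have four edges
with `vx` and three without it. On the remaining ones nothing changes. -/
theorem link_gain_le {a : V → V → Bool} {t : V → Bool} {v x : V} (hvx : v ≠ x)
    (ht : t v = t x) (hav : a v x = true) (z w : V) :
    linkInd a v (a v) x z w - linkInd a v (Function.update (a v) x false) x z w ≤
      -ind (bip t z w) + 2 * (wrong a t v z + wrong a t v w + wrong a t x z + wrong a t x w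
        + wrong a t z w + (if v = z then 1 else 0) + (if v = w then 1 else 0)
        + (if x = z then 1 else 0) + (if x = w then 1 else 0)) := by
  have w0 := wrong_nonneg a t
  have := w0 v z; have := w0 v w; have := w0 x z; have := w0 x w; have := w0 z w
  have i0 : ∀ p : Prop, [Decidable p] → (0 : ℝ) ≤ if p then 1 else 0 := by
    intro p _; split_ifs <;> norm_num
  have j1 := i0 (v = z); have j2 := i0 (v = w); have j3 := i0 (x = z); have j4 := i0 (x = w)
  have b1 := ind_le_one (bip t z w)
  have l1 : linkInd a v (a v) x z w ≤ 1 := by unfold linkInd; split_ifs <;> norm_num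
  have l0 : 0 ≤ linkInd a v (Function.update (a v) x false) x z w := by
    unfold linkInd; split_ifs <;> norm_num
  by_cases h1 : wrong a t v z = 1
  · linarith
  by_cases h2 : wrong a t v w = 1
  · linarith
  by_cases h3 : wrong a t x z = 1
  · linarith
  by_cases h4 : wrong a t x w = 1
  · linarith
  by_cases h5 : wrong a t z w = 1
  · linarith
  by_cases hvz : v = z
  · rw [if_pos hvz] at *; linarith
  by_cases hvw : v = w
  · rw [if_pos hvw] at *; linarith
  by_cases hxz : x = z
  · rw [if_pos hxz] at *; linarith
  by_cases hxw : x = w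
  · rw [if_pos hxw] at *; linarith
  by_cases hzw : z = w
  · subst hzw
    have : linkInd a v (a v) x z z = 0 := by simp [linkInd]
    have : ind (bip t z z) = 0 := by simp [bip]
    linarith
  have key : linkInd a v (a v) x z w - linkInd a v (Function.update (a v) x false) x z w ≤
      -ind (bip t z w) := by
    simp only [linkInd, Function.update_self, Function.update_of_ne (Ne.symm hxz),
      Function.update_of_ne (Ne.symm hxw), wrong_eq_zero h1, wrong_eq_zero h2, wrong_eq_zero h3,
      wrong_eq_zero h4, wrong_eq_zero h5, hav, hvx, hvz, hvw, hxz, hxw, hzw, bip, ht, ne_eq,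
      not_false_eq_true, true_and]
    cases t x <;> cases t z <;> cases t w <;> norm_num
  linarith

theorem sum_ind_bip (t : V → Bool) :
    ∑ z, ∑ w, ind (bip t z w) = 2 * (side t * side fun x => !t x) := by
  have : ∀ z w, ind (bip t z w) = ind (t z) * ind (!t w) + ind (!t z) * ind (t w) := by
    intro z w
    unfold bip
    cases t z <;> cases t w <;> simp
  simp only [this, Finset.sum_add_distrib, ← Finset.mul_sum, ← Finset.sum_mul, side]
  ring

theorem no_edge_inside {a : V → V → Bool} (sym : ∀ x y, a x y = a y x)
    (irr : ∀ x, a x x = false) (hext : IsExtremal a) {t : V → Bool}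
    (hdeg : ∀ v, ∑ y, wrong a t v y ≤ (Fintype.card V : ℝ) / 100)
    (herr : 25 / 100 * (Fintype.card V : ℝ) ^ 2 + 2 * discrepancy a t + 8 * Fintype.card V <
      2 * (side t * side fun x => !t x)) {v x : V} (ht : t v = t x) : a v x = false := by
  by_contra hav
  rw [Bool.not_eq_false] at hav
  have hvx : v ≠ x := by rintro rfl; simp [irr] at hav
  have h1 := hext.linkCount_le sym irr v (Function.update (a v) x false)
  have h2 := linkCount_sub_update sym v x (a v) false
  have h3 : ∑ z, ∑ w, (linkInd a v (a v) x z w -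
      linkInd a v (Function.update (a v) x false) x z w) ≤ _ :=
    Finset.sum_le_sum fun z _ => Finset.sum_le_sum fun w _ => link_gain_le hvx ht hav z w
  simp only [Finset.sum_add_distrib, Finset.sum_neg_distrib, ← Finset.mul_sum, sum_ind_bip,
    sum_wrong, Finset.sum_const, Finset.card_univ, nsmul_eq_mul, Finset.sum_ite_eq, Finset.mem_univ,
    if_true] at h3
  have hn : (0 : ℝ) ≤ Fintype.card V := Nat.cast_nonneg _
  have h4 := mul_le_mul_of_nonneg_left (hdeg v) hn
  have h5 := mul_le_mul_of_nonneg_left (hdeg x) hn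
  nlinarith

end

/-! ### The cost of missing cross pairs -/

section

variable {V : Type*} [Fintype V] [DecidableEq V]

/-- Indicator of the missing cross pairs `(x, y)`, with `x` on the side `t = true`. -/
def missing (a : V → V → Bool) (t : V → Bool) (x y : V) : ℝ := ind (t x && !t y && !a x y)

/-- The factor for `x'y'` is expanded by `(1 - p) (1 - q) (1 - r) ≤ (1 - p) (1 - q) - r (1 - p - q)`. -/
theorem pathInd_le (a : V → V → Bool) (t : V → Bool) (x y x' y' : V) :
    pathInd a t x y x' y' ≤
      missing a t x y * (ind (!t y') - missing a t x y') * (ind (t x') - missing a t x' y)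
      - missing a t x y * missing a t x' y' + missing a t x y * missing a t x' y' * missing a t x y'
      + missing a t x y * missing a t x' y' * missing a t x' y := by
  unfold pathInd missing
  cases t x <;> cases t y <;> cases t x' <;> cases t y' <;> simp
  cases a x y <;> cases a x' y' <;> cases a x y' <;> cases a x' y <;> norm_num

theorem missing_nonneg (a : V → V → Bool) (t : V → Bool) (x y : V) : 0 ≤ missing a t x y :=
  ind_nonneg _

/-- The number of missing cross pairs at a vertex `x` of the side `t = true`. -/
def missRow (a : V → V → Bool) (t : V → Bool) (x : V) : ℝ := ∑ y, missing a t x y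

/-- The number of missing cross pairs at a vertex `y` of the side `t = false`. -/
def missCol (a : V → V → Bool) (t : V → Bool) (y : V) : ℝ := ∑ x, missing a t x y

/-- The number of missing cross pairs. -/
def missCount (a : V → V → Bool) (t : V → Bool) : ℝ := ∑ x, ∑ y, missing a t x y

theorem sum_missRow (a : V → V → Bool) (t : V → Bool) : ∑ x, missRow a t x = missCount a t := rfl

theorem sum_missCol (a : V → V → Bool) (t : V → Bool) : ∑ y, missCol a t y = missCount a t :=
  Finset.sum_comm

theorem sum_pathInd_le (a : V → V → Bool) (t : V → Bool) :
    ∑ x, ∑ y, ∑ x', ∑ y', pathInd a t x y x' y' ≤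
      missCount a t * (side t * side fun x => !t x) - side t * ∑ x, missRow a t x ^ 2
        - (side fun x => !t x) * ∑ y, missCol a t y ^ 2
        + 3 * ∑ x, ∑ y, missing a t x y * (missRow a t x * missCol a t y) - missCount a t ^ 2 := by
  have h := Finset.sum_le_sum fun x (_ : x ∈ univ) => Finset.sum_le_sum fun y (_ : y ∈ univ) =>
    Finset.sum_le_sum fun x' (_ : x' ∈ univ) => Finset.sum_le_sum fun y' (_ : y' ∈ univ) =>
      pathInd_le a t x y x' y'
  refine h.trans (le_of_eq ?_)
  simp only [Finset.sum_add_distrib, Finset.sum_sub_distrib]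
  have e1 : ∑ x, ∑ y, ∑ x', ∑ y', missing a t x y * (ind (!t y') - missing a t x y') *
      (ind (t x') - missing a t x' y) = ∑ x, ∑ y, missing a t x y *
        ((side fun x => !t x) - missRow a t x) * (side t - missCol a t y) := by
    simp only [← Finset.mul_sum, ← Finset.sum_mul, Finset.sum_sub_distrib]
    rfl
  have e2 : ∑ x, ∑ y, ∑ x', ∑ y', missing a t x y * missing a t x' y' = missCount a t ^ 2 := by
    simp only [← Finset.mul_sum, ← Finset.sum_mul, missCount, sq]
  have e3 : ∑ x, ∑ y, ∑ x', ∑ y', missing a t x y * missing a t x' y' * missing a t x y' =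
      ∑ x, ∑ y, missing a t x y * (missRow a t x * missCol a t y) := by
    refine Finset.sum_congr rfl fun x _ => ?_
    rw [Finset.sum_congr rfl fun y _ => Finset.sum_comm, Finset.sum_comm]
    refine Finset.sum_congr rfl fun y' _ => ?_
    simp only [missRow, missCol, ← Finset.mul_sum, ← Finset.sum_mul]
    ring
  have e4 : ∑ x, ∑ y, ∑ x', ∑ y', missing a t x y * missing a t x' y' * missing a t x' y =
      ∑ x, ∑ y, missing a t x y * (missRow a t x * missCol a t y) := by
    rw [Finset.sum_comm]
    rw [Finset.sum_congr rfl fun y _ => Finset.sum_comm, Finset.sum_comm]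
    refine Finset.sum_congr rfl fun x' _ => Finset.sum_congr rfl fun y _ => ?_
    simp only [missRow, missCol, ← Finset.mul_sum, ← Finset.sum_mul]
    ring
  have e5 : ∑ x, ∑ y, missing a t x y * missRow a t x = ∑ x, missRow a t x ^ 2 := by
    simp only [← Finset.sum_mul, sq]
    rfl
  have e6 : ∑ x, ∑ y, missing a t x y * missCol a t y = ∑ y, missCol a t y ^ 2 := by
    rw [Finset.sum_comm]
    simp only [← Finset.sum_mul, sq]
    rfl
  have e7 : ∑ x, ∑ y, missing a t x y *
        ((side fun x => !t x) - missRow a t x) * (side t - missCol a t y) =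
      missCount a t * (side t * side fun x => !t x) - side t * ∑ x, missRow a t x ^ 2
        - (side fun x => !t x) * ∑ y, missCol a t y ^ 2
        + ∑ x, ∑ y, missing a t x y * (missRow a t x * missCol a t y) := by
    rw [← e5, ← e6, missCount]
    simp only [Finset.mul_sum, Finset.sum_mul, ← Finset.sum_add_distrib, ← Finset.sum_sub_distrib]
    refine Finset.sum_congr rfl fun x _ => Finset.sum_congr rfl fun y _ => ?_
    ring
  rw [e1, e2, e3, e4, e7]
  ring

theorem missRow_of_false {a : V → V → Bool} {t : V → Bool} {x : V} (h : t x = false) :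
    missRow a t x = 0 := by
  simp [missRow, missing, h]

theorem missCol_of_true {a : V → V → Bool} {t : V → Bool} {x : V} (h : t x = true) :
    missCol a t x = 0 := by
  simp [missCol, missing, h]

theorem deg_of_true {a : V → V → Bool} {t : V → Bool} (h : ∀ x y, t x = t y → a x y = false)
    {x : V} (hx : t x = true) : deg a x = (side fun x => !t x) - missRow a t x := by
  simp only [deg, side, missRow, missing, ← Finset.sum_sub_distrib]
  refine Finset.sum_congr rfl fun y _ => ?_
  have := h x y
  rw [hx] at this ⊢
  cases hy : t y
  · cases a x y <;> simp
  · rw [this hy.symm]; simp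

theorem deg_of_false {a : V → V → Bool} (sym : ∀ x y, a x y = a y x) {t : V → Bool}
    (h : ∀ x y, t x = t y → a x y = false)
    {x : V} (hx : t x = false) : deg a x = side t - missCol a t x := by
  simp only [deg, side, missCol, missing, ← Finset.sum_sub_distrib]
  refine Finset.sum_congr rfl fun y _ => ?_
  have := h x y
  rw [hx] at this ⊢
  rw [sym y x]
  cases hy : t y
  · rw [this hy.symm]; simp
  · cases a x y <;> simp

theorem missRow_nonneg (a : V → V → Bool) (t : V → Bool) (x : V) : 0 ≤ missRow a t x :=
  Finset.sum_nonneg fun _ _ => missing_nonneg _ _ _ _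

theorem missCol_nonneg (a : V → V → Bool) (t : V → Bool) (x : V) : 0 ≤ missCol a t x :=
  Finset.sum_nonneg fun _ _ => missing_nonneg _ _ _ _

/-- The stars of a bipartite graph, compared with those of the complete bipartite graph: expand
`d (d - 1) (d - 2)` at `d = B - f` and drop the negative cubic term. -/
theorem sum_deg_le {a : V → V → Bool} (sym : ∀ x y, a x y = a y x) {t : V → Bool}
    (h : ∀ x y, t x = t y → a x y = false) {A B : ℝ} (hA : A = side t)
    (hB : B = side fun x => !t x) :
    4 * ∑ p, deg a p * (deg a p - 1) * (deg a p - 2) ≤ starCount A B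
      - 4 * missCount a t * (3 * A ^ 2 + 3 * B ^ 2 - 6 * (A + B) + 4)
      + 12 * (B - 1) * ∑ x, missRow a t x ^ 2 + 12 * (A - 1) * ∑ y, missCol a t y ^ 2 := by
  have key : ∀ p, deg a p * (deg a p - 1) * (deg a p - 2) ≤
      ind (t p) * (B * (B - 1) * (B - 2)) + ind (!t p) * (A * (A - 1) * (A - 2))
      - missRow a t p * (3 * B ^ 2 - 6 * B + 2) - missCol a t p * (3 * A ^ 2 - 6 * A + 2)
      + 3 * (B - 1) * missRow a t p ^ 2 + 3 * (A - 1) * missCol a t p ^ 2 := by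
    intro p
    cases hp : t p
    · rw [deg_of_false sym h hp, missRow_of_false hp, ← hA]
      have := pow_nonneg (missCol_nonneg a t p) 3
      simp
      nlinarith
    · rw [deg_of_true h hp, missCol_of_true hp, ← hB]
      have := pow_nonneg (missRow_nonneg a t p) 3
      simp
      nlinarith
  have h1 := Finset.sum_le_sum fun p (_ : p ∈ univ) => key p
  simp only [Finset.sum_add_distrib, Finset.sum_sub_distrib, ← Finset.mul_sum, ← Finset.sum_mul,
    sum_missRow, sum_missCol] at h1
  have h2 : ∑ x, ind (t x) = A := hA.symm
  have h3 : ∑ x, ind (!t x) = B := hB.symm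
  rw [h2, h3] at h1
  unfold starCount
  linarith

/-- If `k` cross pairs are missing, at most `M` of them at each vertex, then the paths gained exceed the
stars lost by at most `k ((n - (A - B) ^ 2) / 2 + 3 M - k)`, up to the factor `24`. -/
theorem quadCount_le_of_bipartite {a : V → V → Bool} (sym : ∀ x y, a x y = a y x)
    (irr : ∀ x, a x x = false) {t : V → Bool} (h : ∀ x y, t x = t y → a x y = false) {A B M : ℝ}
    (hA : A = side t) (hB : B = side fun x => !t x) (hr : ∀ x, missRow a t x ≤ M)
    (hc : ∀ x, missCol a t x ≤ M) (h₁ : B / 2 + 3 / 2 * M ≤ A) (h₂ : A / 2 + 3 / 2 * M ≤ B) :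
    quadCount a ≤ starCount A B + 24 * (missCount a t *
      ((A + B - (A - B) ^ 2) / 2 + 3 * M - missCount a t)) := by
  have h1 := quadCount_of_bipartite sym irr h
  have h2 := sum_deg_le sym h hA hB
  have h3 := sum_pathInd_le a t
  rw [← hA, ← hB] at h3
  rw [sum_starInd] at h1
  have m0 := missing_nonneg a t
  have hR : missCount a t ≤ ∑ x, missRow a t x ^ 2 := by
    refine Finset.sum_le_sum fun x _ => ?_
    have e : missRow a t x ^ 2 = ∑ y, missing a t x y * missRow a t x := by
      rw [← Finset.sum_mul, sq]; rfl
    rw [e]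
    refine Finset.sum_le_sum fun y _ => ?_
    have h1 : missing a t x y ≤ missRow a t x :=
      Finset.single_le_sum (f := fun y => missing a t x y) (fun y _ => m0 x y) (mem_univ y)
    calc missing a t x y = missing a t x y * missing a t x y := (ind_mul_self _).symm
      _ ≤ _ := mul_le_mul_of_nonneg_left h1 (m0 x y)
  have hC : missCount a t ≤ ∑ y, missCol a t y ^ 2 := by
    rw [← sum_missCol]
    refine Finset.sum_le_sum fun y _ => ?_
    have e : missCol a t y ^ 2 = ∑ x, missing a t x y * missCol a t y := by
      rw [← Finset.sum_mul, sq]; rfl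
    rw [e]
    refine Finset.sum_le_sum fun x _ => ?_
    have h1 : missing a t x y ≤ missCol a t y :=
      Finset.single_le_sum (f := fun x => missing a t x y) (fun x _ => m0 x y) (mem_univ x)
    calc missing a t x y = missing a t x y * missing a t x y := (ind_mul_self _).symm
      _ ≤ _ := mul_le_mul_of_nonneg_left h1 (m0 x y)
  have hQ : ∑ x, ∑ y, missing a t x y * (missRow a t x * missCol a t y) ≤
      M / 2 * (∑ x, missRow a t x ^ 2 + ∑ y, missCol a t y ^ 2) := by
    have e5 : ∑ x, ∑ y, missing a t x y * missRow a t x = ∑ x, missRow a t x ^ 2 := by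
      simp only [← Finset.sum_mul, sq]
      rfl
    have e6 : ∑ x, ∑ y, missing a t x y * missCol a t y = ∑ y, missCol a t y ^ 2 := by
      rw [Finset.sum_comm]
      simp only [← Finset.sum_mul, sq]
      rfl
    rw [← e5, ← e6]
    simp only [← Finset.sum_add_distrib, Finset.mul_sum]
    refine Finset.sum_le_sum fun x _ => Finset.sum_le_sum fun y _ => ?_
    have g1 := mul_le_mul_of_nonneg_right (hr x) (missCol_nonneg a t y)
    have g2 := mul_le_mul_of_nonneg_right (hc y) (missRow_nonneg a t x)
    have := mul_le_mul_of_nonneg_left (show missRow a t x * missCol a t y ≤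
      M / 2 * (missRow a t x + missCol a t y) by linarith) (m0 x y)
    linarith
  -- The coefficients of the sums of squares are negative, so the sums may be replaced by `k`.
  have f1 := mul_le_mul_of_nonneg_left hR (show 0 ≤ A - B / 2 - 3 / 2 * M by linarith)
  have f2 := mul_le_mul_of_nonneg_left hC (show 0 ≤ B - A / 2 - 3 / 2 * M by linarith)
  have k0 : 0 ≤ missCount a t := Finset.sum_nonneg fun x _ => missRow_nonneg a t x
  have R0 := k0.trans hR
  have C0 := k0.trans hC
  linarith

end

/-! ### Extremal graphs are complete bipartite up to complement -/

section

/-- A square `d ^ 2` close to `3 n - 4` with `d ≡ n` modulo `2`, so that `n` splits into two sides that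
differ by `d`. -/
theorem exists_sq_near (n : ℕ) (hn : 2000 ≤ n) :
    ∃ d m : ℕ, 2 * m = n + d ∧ d ≤ n ∧ |(d : ℝ) ^ 2 - (3 * (n : ℝ) - 4)| ≤ (n : ℝ) / 10 := by
  set r := Nat.sqrt (3 * n) with hr
  have h1 : r * r ≤ 3 * n := Nat.sqrt_le _
  have h2 : 3 * n < (r + 1) * (r + 1) := Nat.lt_succ_sqrt _
  have h3 : 20 * r + 50 ≤ n := by nlinarith
  have h1' : (r : ℝ) * r ≤ 3 * n := by exact_mod_cast h1
  have h2' : (3 * n : ℝ) ≤ (r + 1) * (r + 1) := by exact_mod_cast h2.le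
  have h3' : (20 * r + 50 : ℝ) ≤ n := by exact_mod_cast h3
  rcases Nat.even_or_odd (n + r) with ⟨m, hm⟩ | ⟨m, hm⟩
  · refine ⟨r, m, by omega, by omega, abs_le.2 ⟨?_, ?_⟩⟩ <;> nlinarith
  · refine ⟨r + 1, m + 1, by omega, by omega, abs_le.2 ⟨?_, ?_⟩⟩ <;> push_cast <;> nlinarith

variable {V : Type*} [Fintype V] [DecidableEq V]

theorem side_eq_card (s : Finset V) : side (fun x => decide (x ∈ s)) = #s := by
  have h : ∀ x, ind (decide (x ∈ s)) = if x ∈ s then 1 else 0 := by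
    intro x
    by_cases h : x ∈ s <;> simp [h]
  simp [side, h]

theorem exists_balanced (hn : 2000 ≤ Fintype.card V) : ∃ t : V → Bool,
    (((Fintype.card V : ℝ) ^ 2 - (3 * Fintype.card V - 4)) ^ 2 - (Fintype.card V / 10 : ℝ) ^ 2) / 2
      ≤ quadCount (bip t) := by
  obtain ⟨d, m, hm, hd, h⟩ := exists_sq_near _ hn
  obtain ⟨s, -, hs⟩ := Finset.exists_subset_card_eq (s := (univ : Finset V)) (n := m)
    (by rw [Finset.card_univ]; omega)
  refine ⟨fun x => decide (x ∈ s), ?_⟩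
  have h1 := side_add_side_not fun x => decide (x ∈ s)
  have h2 := side_eq_card s
  rw [hs] at h2
  have h3 : (2 * m : ℝ) = Fintype.card V + d := by exact_mod_cast hm
  rw [quadCount_bip, starCount_eq, h1]
  set n : ℝ := (Fintype.card V : ℝ)
  have h4 : (side fun x => decide (x ∈ s)) - (side fun x => !decide (x ∈ s)) = d := by linarith
  rw [h4]
  have h5 : ((d : ℝ) ^ 2 - (3 * n - 4)) ^ 2 ≤ (n / 10) ^ 2 := sq_le_sq.2 (h.trans (le_abs_self _))
  linarith

theorem bip_symm (t : V → Bool) (x y : V) : bip t x y = bip t y x := Bool.xor_comm _ _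

theorem bip_irrefl (t : V → Bool) (x : V) : bip t x x = false := by simp [bip]

theorem IsExtremal.le_quadCount {a : V → V → Bool} (h : IsExtremal a)
    (hn : 2000 ≤ Fintype.card V) :
    (((Fintype.card V : ℝ) ^ 2 - (3 * Fintype.card V - 4)) ^ 2 - (Fintype.card V / 10 : ℝ) ^ 2) / 2
      ≤ quadCount a := by
  obtain ⟨t, ht⟩ := exists_balanced (V := V) hn
  exact ht.trans (h _ (bip_symm t) (bip_irrefl t))

theorem IsExtremal.le_quadCount' {a : V → V → Bool} (h : IsExtremal a)
    (hn : 2000 ≤ Fintype.card V) :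
    (Fintype.card V : ℝ) ^ 4 / 2 - 3 * (Fintype.card V : ℝ) ^ 3 ≤ quadCount a := by
  refine le_trans ?_ (h.le_quadCount hn)
  have : (2000 : ℝ) ≤ Fintype.card V := by exact_mod_cast hn
  nlinarith

theorem missing_le_wrong (a : V → V → Bool) (t : V → Bool) (x y : V) :
    missing a t x y ≤ wrong a t x y := by
  unfold missing wrong bip
  cases t x <;> cases t y <;> cases a x y <;> simp

/-- A sufficiently large extremal graph that is close to some complete bipartite graph is itself
complete bipartite. -/
theorem exists_eq_bip {a : V → V → Bool} (sym : ∀ x y, a x y = a y x) (irr : ∀ x, a x x = false)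
    (hext : IsExtremal a) (hn : (10 : ℝ) ^ 21 ≤ Fintype.card V)
    (hs : ∃ s, (discrepancy a s : ℝ) ≤ 1 / 10 ^ 22 * (Fintype.card V : ℝ) ^ 2) :
    ∃ t, a = bip t := by
  obtain ⟨s, hs⟩ := hs
  obtain ⟨t, -, hmin⟩ := Finset.exists_min_image (univ : Finset (V → Bool)) (discrepancy a)
    ⟨s, mem_univ s⟩
  replace hmin := fun u => hmin u (mem_univ u)
  have hD : (discrepancy a t : ℝ) ≤ 1 / 10 ^ 22 * (Fintype.card V : ℝ) ^ 2 :=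
    (Nat.cast_le.2 (hmin s)).trans hs
  have hD0 : (0 : ℝ) ≤ discrepancy a t := Nat.cast_nonneg _
  have hn' : 2000 ≤ Fintype.card V := by
    have : ((2000 : ℕ) : ℝ) ≤ Fintype.card V := le_trans (by norm_num) hn
    exact_mod_cast this
  have hq := hext.le_quadCount' hn'
  have hq' := hext.le_quadCount hn'
  have hb := quadCount_le_bip a t
  have hsum := side_add_side_not t
  have hhalf := sum_wrong_le_half sym irr hmin
  have hvert := fun v hbal herr => sum_wrong_le sym irr hext (t := t) (v := v) (hhalf v) hbal herr
  have hedge := fun hdeg herr v x => no_edge_inside sym irr hext (t := t) hdeg herr (v := v) (x := x)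
  have hstar : starCount (side t) (side fun x => !t x) ≤ quadCount a := by
    rw [← quadCount_bip]
    exact hext _ (bip_symm t) (bip_irrefl t)
  set n : ℝ := (Fintype.card V : ℝ) with hnn
  set D : ℝ := (discrepancy a t : ℝ)
  obtain ⟨A, hA⟩ : ∃ A, A = side t := ⟨_, rfl⟩
  obtain ⟨B, hB⟩ : ∃ B, B = side fun x => !t x := ⟨_, rfl⟩
  rw [← hA, ← hB] at hb hsum hstar hvert hedge
  have hn0 : 0 < n := lt_of_lt_of_le (by norm_num) hn
  have hA' : A = n - B := by linarith
  have hn2 : 10 ^ 21 * n ≤ n ^ 2 := by rw [sq]; exact mul_le_mul_of_nonneg_right hn hn0.le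
  have hn3 : 10 ^ 21 * n ^ 2 ≤ n ^ 3 := by
    rw [pow_succ n 2, mul_comm]; exact mul_le_mul_of_nonneg_left hn (by positivity)
  have hn4 : 10 ^ 21 * n ^ 3 ≤ n ^ 4 := by
    rw [pow_succ n 3, mul_comm]; exact mul_le_mul_of_nonneg_left hn (by positivity)
  -- The sides are balanced: `(A - B) ^ 4` is at most `12 D n ^ 2 + 6 n ^ 3`, which the choice of the
  -- constants `10 ^ 22` and `10 ^ 21` makes smaller than `(n / 10 ^ 5) ^ 4`.
  have hbal : |A - B| ≤ n / 100000 := by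
    have e1 : 4 * (A * B) * (A ^ 2 + B ^ 2) = (n ^ 4 - (A - B) ^ 4) / 2 := by rw [hA']; ring
    have e2 : D * n ^ 2 ≤ 1 / 10 ^ 22 * n ^ 2 * n ^ 2 :=
      mul_le_mul_of_nonneg_right hD (by positivity)
    have e3 : |A - B| ^ 4 ≤ (n / 100000) ^ 4 := by
      rw [Even.pow_abs (by decide)]
      linarith
    exact le_of_pow_le_pow_left₀ (by norm_num) (by positivity) e3
  have hbal2 : (A - B) ^ 2 ≤ (n / 100000) ^ 2 := sq_le_sq.2 (hbal.trans (le_abs_self _))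
  have hdeg : ∀ v, ∑ y, wrong a t v y ≤ n / 100 := by
    intro v
    refine hvert v hbal ?_
    have : D * n ≤ 1 / 10 ^ 22 * n ^ 2 * n := mul_le_mul_of_nonneg_right hD hn0.le
    linarith
  have hin : ∀ x y, t x = t y → a x y = false := by
    refine hedge hdeg ?_
    have : 2 * (A * B) = (n ^ 2 - (A - B) ^ 2) / 2 := by rw [hA']; ring
    linarith
  have hr : ∀ x, missRow a t x ≤ n / 100 := fun x =>
    (Finset.sum_le_sum fun y _ => missing_le_wrong a t x y).trans (hdeg x)
  have hc : ∀ x, missCol a t x ≤ n / 100 := fun y => by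
    refine (Finset.sum_le_sum fun x _ => ?_).trans (hdeg y)
    have e : wrong a t y x = wrong a t x y := by
      unfold wrong
      rw [sym, bip_symm]
    rw [e]
    exact missing_le_wrong a t x y
  obtain ⟨b1, b2⟩ := abs_le.1 hbal
  have hup := quadCount_le_of_bipartite sym irr hin hA hB hr hc (by linarith) (by linarith)
  have m0 := missing_nonneg a t
  have k0 : 0 ≤ missCount a t := Finset.sum_nonneg fun x _ => missRow_nonneg a t x
  obtain ⟨k, hk⟩ : ∃ k, k = missCount a t := ⟨_, rfl⟩
  rw [hsum, ← hk] at hup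
  rw [← hk] at k0
  rcases k0.eq_or_lt with k0 | k0
  · refine ⟨t, funext fun x => funext fun y => ?_⟩
    have z : ∀ x y, missing a t x y = 0 := by
      intro x y
      have h1 : missRow a t x = 0 :=
        (Finset.sum_eq_zero_iff_of_nonneg fun x _ => missRow_nonneg a t x).1
          (hk.symm.trans k0.symm) x (mem_univ x)
      exact (Finset.sum_eq_zero_iff_of_nonneg fun y _ => m0 x y).1 h1 y (mem_univ y)
    have h1 := hin x y
    have h2 := z x y
    have h3 := z y x
    rw [missing, sym y x] at h3
    unfold missing at h2
    unfold bip
    revert h1 h2 h3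
    cases t x <;> cases t y <;> cases a x y <;> simp
  · exfalso
    obtain ⟨T, hT⟩ : ∃ T, T = (A - B) ^ 2 := ⟨_, rfl⟩
    have hT0 : 0 ≤ T := by rw [hT]; positivity
    rw [starCount_eq, hsum, ← hT] at hup hstar
    obtain ⟨c, hcc⟩ : ∃ c, c = (n - T) / 2 + 3 * (n / 100) := ⟨_, rfl⟩
    rw [← hcc] at hup
    -- Comparison with `bip t` shows that the missing pairs are a gain, so `T` is at most about `n`;
    -- then comparison with the best complete bipartite graph yields a contradiction.
    have hkc : 0 ≤ k * (c - k) := by linarith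
    have hc0 : 0 ≤ c := by
      have := nonneg_of_mul_nonneg_right hkc k0
      linarith
    have hk4 : k * (c - k) ≤ c ^ 2 / 4 := by nlinarith [sq_nonneg (c - 2 * k)]
    -- The defect of `T` from its optimal value `3 n - 4` exceeds the gain from the missing pairs.
    have hfin : (3 * n - 4 - T) ^ 2 ≤ (n / 10) ^ 2 + 12 * c ^ 2 := by
      have : (3 * n - 4 - T) ^ 2 = (T - (3 * n - 4)) ^ 2 := by ring
      rw [this]
      linarith
    have hge : 2 * c + 18 / 10 * n ≤ 3 * n - 4 - T := by linarith
    have hcn : c ≤ 53 / 100 * n := by linarith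
    have : (2 * c + 18 / 10 * n) ^ 2 ≤ (3 * n - 4 - T) ^ 2 := by
      gcongr
    have g1 := mul_le_mul_of_nonneg_left hcn hc0
    have g2 := mul_nonneg hc0 hn0.le
    have g3 := pow_pos hn0 2
    linarith

theorem quadCount_coAdj {a : V → V → Bool} : quadCount (coAdj a) = quadCount a := by
  refine Finset.sum_congr rfl fun p _ => Finset.sum_congr rfl fun q _ =>
    Finset.sum_congr rfl fun r _ => Finset.sum_congr rfl fun s _ => ?_
  unfold quadInd
  refine if_congr ?_ rfl rfl
  unfold edgeSum coAdj
  constructor <;> rintro ⟨h1, h2, h3, h4, h5, h6, h7⟩ <;>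
    refine ⟨h1, h2, h3, h4, h5, h6, ?_⟩ <;> revert h7 <;> simp only [h1, h2, h3, h4, h5, h6] <;>
    cases a p q <;> cases a p r <;> cases a p s <;> cases a q r <;> cases a q s <;> cases a r s <;>
    simp

theorem coAdj_symm {a : V → V → Bool} (sym : ∀ x y, a x y = a y x) (x y : V) :
    coAdj a x y = coAdj a y x := by
  simp only [coAdj, sym x y, eq_comm (a := x)]

theorem coAdj_irrefl (a : V → V → Bool) (x : V) : coAdj a x x = false := by simp [coAdj]

theorem IsExtremal.coAdj {a : V → V → Bool} (h : IsExtremal a) : IsExtremal (coAdj a) := by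
  intro a' sym irr
  rw [quadCount_coAdj]
  exact h a' sym irr

theorem exists_bip_of_isExtremal : ∃ n₀ : ℕ, ∀ (V : Type*) [Fintype V] [DecidableEq V]
    (a : V → V → Bool), (∀ x y, a x y = a y x) → (∀ x, a x x = false) → IsExtremal a →
    n₀ ≤ Fintype.card V → ∃ t, a = bip t ∨ coAdj a = bip t := by
  obtain ⟨n₀, h⟩ := exists_discrepancy_le_or_coAdj (ε := 1 / 10 ^ 22) (C := 3) (by norm_num)
  refine ⟨max n₀ (10 ^ 21), fun V _ _ a sym irr hext hn => ?_⟩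
  have hn1 : (10 : ℝ) ^ 21 ≤ Fintype.card V := by
    have : 10 ^ 21 ≤ Fintype.card V := (le_max_right _ _).trans hn
    exact_mod_cast this
  have hn2 : 2000 ≤ Fintype.card V :=
    le_trans (by norm_num) ((le_max_right _ _).trans hn)
  rcases h V a sym ((le_max_left _ _).trans hn) (hext.le_quadCount' hn2) with hs | hs
  · obtain ⟨t, ht⟩ := exists_eq_bip sym irr hext hn1 hs
    exact ⟨t, Or.inl ht⟩
  · obtain ⟨t, ht⟩ := exists_eq_bip (coAdj_symm sym) (coAdj_irrefl a) hext.coAdj hn1 hs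
    exact ⟨t, Or.inr ht⟩

end

/-! ### From adjacency functions to graphs -/

section

open scoped Classical in
/-- The adjacency of `G` as a Boolean function. -/
noncomputable def adjBool {V : Type*} (G : SimpleGraph V) (x y : V) : Bool := decide (G.Adj x y)

theorem adjBool_eq_true {V : Type*} {G : SimpleGraph V} {x y : V} :
    adjBool G x y = true ↔ G.Adj x y := by simp [adjBool]

theorem adjBool_symm {V : Type*} (G : SimpleGraph V) (x y : V) : adjBool G x y = adjBool G y x := by
  rw [Bool.eq_iff_iff, adjBool_eq_true, adjBool_eq_true, G.adj_comm]

theorem adjBool_irrefl {V : Type*} (G : SimpleGraph V) (x : V) : adjBool G x x = false := by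
  rw [← Bool.not_eq_true, adjBool_eq_true]
  exact G.irrefl

theorem ncard_edgeSet_fin_four (H : SimpleGraph (Fin 4)) :
    H.edgeSet.ncard = edgeSum (adjBool H) 0 1 2 3 := by
  classical
  have h1 := H.sum_degrees_eq_twice_card_edges
  have h2 : ∀ i, H.degree i = ∑ j, (adjBool H i j).toNat := by
    intro i
    rw [← SimpleGraph.card_neighborFinset_eq_degree, SimpleGraph.neighborFinset_eq_filter,
      Finset.card_filter]
    refine Finset.sum_congr rfl fun j _ => ?_
    by_cases h : H.Adj i j <;> simp [adjBool, h]
  rw [← SimpleGraph.coe_edgeFinset, Set.ncard_coe_finset]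
  simp only [h2, Fin.sum_univ_four, adjBool_irrefl, adjBool_symm H 1 0, adjBool_symm H 2 0,
    adjBool_symm H 3 0, adjBool_symm H 2 1, adjBool_symm H 3 1, adjBool_symm H 3 2] at h1
  unfold edgeSum
  simp only [Bool.toNat_false] at h1
  omega

theorem ncard_edgeSet_induce {V : Type*} [DecidableEq V] (G : SimpleGraph V) {v : Fin 4 → V}
    (hv : Function.Injective v) {X : Finset V} (hX : Finset.univ.image v = X) :
    (G.induce (X : Set V)).edgeSet.ncard = edgeSum (adjBool G) (v 0) (v 1) (v 2) (v 3) := by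
  have hX' : Set.range v = (X : Set V) := by rw [← hX]; simp
  let e : Fin 4 ≃ (X : Set V) := (Equiv.ofInjective v hv).trans (Equiv.setCongr hX')
  have iso : G.comap v ≃g G.induce (X : Set V) := ⟨e, fun {i j} => Iff.rfl⟩
  have h1 := ncard_edgeSet_fin_four (G.comap v)
  rw [← Nat.card_coe_set_eq, Nat.card_congr iso.mapEdgeSet, Nat.card_coe_set_eq] at h1
  exact h1

variable {V : Type*} [Fintype V] [DecidableEq V]

theorem card_injective_image_eq {X : Finset V} (hX : #X = 4) :
    #{v : Fin 4 → V | Function.Injective v ∧ Finset.univ.image v = X} = 24 := by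
  have h1 : Fintype.card (Fin 4 ↪ X) = 24 := by
    rw [Fintype.card_embedding_eq, Fintype.card_coe, hX, Fintype.card_fin]
    rfl
  rw [← h1, ← Finset.card_univ]
  symm
  refine Finset.card_bij (fun f _ i => (f i : V)) ?_ ?_ ?_
  · intro f _
    have hinj : Function.Injective fun i => (f i : V) :=
      Subtype.val_injective.comp f.injective
    refine mem_filter.2 ⟨mem_univ _, hinj, ?_⟩
    refine Finset.eq_of_subset_of_card_le ?_ ?_
    · intro x hx
      obtain ⟨i, -, rfl⟩ := mem_image.1 hx
      exact (f i).2
    · rw [Finset.card_image_of_injective _ hinj, hX]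
      simp
  · intro f _ g _ hfg
    ext i
    exact congrFun hfg i
  · intro v hv
    obtain ⟨-, hinj, him⟩ := mem_filter.1 hv
    refine ⟨⟨fun i => ⟨v i, him ▸ mem_image_of_mem v (mem_univ i)⟩, fun i j hij => ?_⟩,
      mem_univ _, rfl⟩
    exact hinj (congrArg Subtype.val hij)

/-- Each counted set of four vertices has `24` orderings. -/
theorem quadCount_adjBool (G : SimpleGraph V) :
    quadCount (adjBool G) = 24 * edgeStatCount 4 3 G := by
  classical
  have h1 : quadCount (adjBool G) = #{v : Fin 4 → V | Function.Injective v ∧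
      edgeSum (adjBool G) (v 0) (v 1) (v 2) (v 3) = 3} := by
    rw [quadCount, ← sum_fin_four, ← Finset.sum_boole]
    exact Finset.sum_congr rfl fun v _ => quadInd_eq_ite _ v
  have h2 : edgeStatCount 4 3 G =
      #{X : Finset V | #X = 4 ∧ (G.induce (X : Set V)).edgeSet.ncard = 3} := by
    rw [edgeStatCount, ← Set.ncard_coe_finset]
    simp
  have h3 : #{v : Fin 4 → V | Function.Injective v ∧
      edgeSum (adjBool G) (v 0) (v 1) (v 2) (v 3) = 3} = 24 *
      #{X : Finset V | #X = 4 ∧ (G.induce (X : Set V)).edgeSet.ncard = 3} := by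
    rw [Finset.card_eq_sum_card_fiberwise (f := fun v : Fin 4 → V => Finset.univ.image v)
      (t := {X : Finset V | #X = 4 ∧ (G.induce (X : Set V)).edgeSet.ncard = 3})]
    · rw [Finset.sum_const_nat (m := 24), mul_comm]
      intro X hX
      obtain ⟨-, hX4, hX3⟩ := mem_filter.1 hX
      rw [← card_injective_image_eq hX4, Finset.filter_filter]
      congr 1
      refine Finset.filter_congr fun v _ => ?_
      constructor
      · rintro ⟨⟨h, -⟩, h'⟩
        exact ⟨h, h'⟩
      · rintro ⟨h, h'⟩
        exact ⟨⟨h, by rw [← ncard_edgeSet_induce G h h', hX3]⟩, h'⟩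
    · intro v hv
      obtain ⟨-, hinj, h3⟩ := mem_filter.1 (Finset.mem_coe.1 hv)
      refine Finset.mem_coe.2 (mem_filter.2 ⟨mem_univ _, ?_, ?_⟩)
      · rw [Finset.card_image_of_injective _ hinj]
        simp
      · rw [ncard_edgeSet_induce G hinj rfl, h3]
  rw [h1, h2, h3]
  push_cast
  ring

theorem quadCount_comp_equiv {W : Type*} [Fintype W] [DecidableEq W] (e : W ≃ V)
    (a : V → V → Bool) : quadCount (fun x y => a (e x) (e y)) = quadCount a := by
  have h : ∀ p q r s, quadInd (fun x y => a (e x) (e y)) p q r s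
      = quadInd a (e p) (e q) (e r) (e s) := by
    intro p q r s
    exact if_congr (by simp [edgeSum]) rfl rfl
  simp only [quadCount, h]
  rw [← e.sum_comp]
  refine Finset.sum_congr rfl fun p _ => ?_
  rw [← e.sum_comp]
  refine Finset.sum_congr rfl fun q _ => ?_
  rw [← e.sum_comp]
  refine Finset.sum_congr rfl fun r _ => ?_
  rw [← e.sum_comp]

theorem edgeStatCount_le_max {n : ℕ} (κ ℓ : ℕ) (G : SimpleGraph (Fin n)) :
    edgeStatCount κ ℓ G ≤ maxEdgeStatCount κ ℓ n := by
  unfold maxEdgeStatCount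
  exact Finset.le_sup (f := fun G => edgeStatCount κ ℓ G) (Finset.mem_univ G)

theorem exists_edgeStatCount_eq_max (κ ℓ n : ℕ) :
    ∃ G : SimpleGraph (Fin n), edgeStatCount κ ℓ G = maxEdgeStatCount κ ℓ n := by
  unfold maxEdgeStatCount
  obtain ⟨G, -, hG⟩ := Finset.exists_mem_eq_sup _ (Finset.univ_nonempty)
    (fun G : SimpleGraph (Fin n) => edgeStatCount κ ℓ G)
  exact ⟨G, hG.symm⟩

/-- The graph with adjacency function `a`. -/
def ofBool (a : V → V → Bool) (sym : ∀ x y, a x y = a y x) (irr : ∀ x, a x x = false) :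
    SimpleGraph V where
  Adj x y := a x y = true
  symm := ⟨fun x y h => by rw [sym y x]; exact h⟩
  loopless := ⟨fun x h => by simp [irr] at h⟩

theorem adjBool_ofBool (a : V → V → Bool) (sym : ∀ x y, a x y = a y x)
    (irr : ∀ x, a x x = false) : adjBool (ofBool a sym irr) = a := by
  funext x y
  rw [Bool.eq_iff_iff, adjBool_eq_true]
  rfl

theorem isExtremal_adjBool {G : SimpleGraph V}
    (h : edgeStatCount 4 3 G = maxEdgeStatCount 4 3 (Fintype.card V)) :
    IsExtremal (adjBool G) := by
  intro a sym irr
  let e : Fin (Fintype.card V) ≃ V := (Fintype.equivFin V).symm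
  have h1 := quadCount_adjBool (ofBool (fun x y => a (e x) (e y)) (fun _ _ => sym _ _)
    (fun _ => irr _))
  rw [adjBool_ofBool, quadCount_comp_equiv] at h1
  rw [h1, quadCount_adjBool, h]
  have := edgeStatCount_le_max 4 3 (ofBool (fun x y => a (e x) (e y)) (fun _ _ => sym _ _)
    (fun _ => irr _))
  have : (_ : ℝ) ≤ _ := Nat.cast_le.2 this
  linarith

/-- The vertices, listed according to the side on which they lie. -/
noncomputable def sideEquiv (t : V → Bool) :
    V ≃ Fin (Fintype.card {x // t x = true}) ⊕ Fin (Fintype.card {x // ¬ t x = true}) :=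
  (Equiv.sumCompl fun x => t x = true).symm.trans
    (Equiv.sumCongr (Fintype.equivFin _) (Fintype.equivFin _))

theorem isLeft_sideEquiv (t : V → Bool) (x : V) : (sideEquiv t x).isLeft = t x := by
  by_cases h : t x = true
  · simp [sideEquiv, h]
  · simp [sideEquiv, h]

theorem iso_completeBipartiteGraph {G : SimpleGraph V} {t : V → Bool} (h : adjBool G = bip t) :
    ∃ a b : ℕ, Nonempty (G ≃g completeBipartiteGraph (Fin a) (Fin b)) := by
  refine ⟨_, _, ⟨sideEquiv t, fun {x y} => ?_⟩⟩
  rw [← adjBool_eq_true (G := G), h]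
  simp only [completeBipartiteGraph, bip, ← Sum.not_isLeft, isLeft_sideEquiv]
  cases t x <;> cases t y <;> simp

theorem iso_sum_top {G : SimpleGraph V} {t : V → Bool} (h : coAdj (adjBool G) = bip t) :
    ∃ a b : ℕ, Nonempty
      (G ≃g SimpleGraph.sum (⊤ : SimpleGraph (Fin a)) (⊤ : SimpleGraph (Fin b))) := by
  refine ⟨_, _, ⟨sideEquiv t, fun {x y} => ?_⟩⟩
  rw [← adjBool_eq_true (G := G)]
  have h1 := congrFun (congrFun h x) y
  have hx := isLeft_sideEquiv t x
  have hy := isLeft_sideEquiv t y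
  have hxy : sideEquiv t x = sideEquiv t y ↔ x = y := (sideEquiv t).injective.eq_iff
  have hirr : x = y → adjBool G x y = false := by rintro rfl; exact adjBool_irrefl G x
  simp only [coAdj, bip, ← hx, ← hy] at h1
  rw [← not_iff_not] at hxy
  revert h1 hxy hirr
  cases sideEquiv t x <;> cases sideEquiv t y <;> cases adjBool G x y <;>
    by_cases hxy : x = y <;> simp [SimpleGraph.sum, hxy]

theorem quadCount_le_of_isExtremal : ∃ n₀ : ℕ, ∀ (V : Type*) [Fintype V] [DecidableEq V]
    (a : V → V → Bool), (∀ x y, a x y = a y x) → (∀ x, a x x = false) → IsExtremal a →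
    n₀ ≤ Fintype.card V →
    quadCount a ≤ ((Fintype.card V : ℝ) ^ 2 - (3 * Fintype.card V - 4)) ^ 2 / 2 := by
  obtain ⟨n₀, h⟩ := exists_bip_of_isExtremal
  refine ⟨n₀, fun V _ _ a sym irr hext hn => ?_⟩
  obtain ⟨t, ht⟩ := h V a sym irr hext hn
  have hq : quadCount a = quadCount (bip t) := by
    rcases ht with ht | ht
    · rw [ht]
    · rw [← ht, quadCount_coAdj]
  rw [hq, quadCount_bip, starCount_eq, side_add_side_not]
  have := sq_nonneg ((side t - side fun x => !t x) ^ 2 - (3 * (Fintype.card V : ℝ) - 4))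
  linarith

end

/-! ### Crown graphs and the failure of perfect stability -/

/-- The complete bipartite graph on two copies of `Fin m`, minus the perfect matching that joins
the two copies of each element. -/
def crownAdj (m : ℕ) : Fin m ⊕ Fin m → Fin m ⊕ Fin m → Bool
  | Sum.inl i, Sum.inr j => !decide (i = j)
  | Sum.inr i, Sum.inl j => !decide (i = j)
  | _, _ => false

theorem crownAdj_symm (m : ℕ) (x y : Fin m ⊕ Fin m) : crownAdj m x y = crownAdj m y x := by
  rcases x with i | i <;> rcases y with j | j <;> simp [crownAdj, eq_comm]

theorem crownAdj_irrefl (m : ℕ) (x : Fin m ⊕ Fin m) : crownAdj m x x = false := by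
  rcases x with i | i <;> rfl

/-- All degrees are `m - 1`, and the paths come from the missing pair at `i` and two further distinct
indices. -/
theorem quadCount_crownAdj (m : ℕ) :
    quadCount (crownAdj m) = 8 * (m : ℝ) ^ 2 * (m - 1) * (m - 2) := by
  have hside : ∀ x y : Fin m ⊕ Fin m, x.isLeft = y.isLeft → crownAdj m x y = false := by
    intro x y
    rcases x with i | i <;> rcases y with j | j <;> simp [crownAdj]
  rw [quadCount_of_bipartite (crownAdj_symm m) (crownAdj_irrefl m) hside, sum_starInd]
  have hsum : ∀ i : Fin m, ∑ j : Fin m, ind (!decide (i = j)) = (m : ℝ) - 1 := by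
    intro i
    have : ∀ j, ind (!decide (i = j)) = 1 - if i = j then 1 else 0 := by
      intro j
      by_cases h : i = j <;> simp [h]
    simp [this]
  have hdeg : ∀ x, deg (crownAdj m) x = (m : ℝ) - 1 := by
    intro x
    rcases x with i | i <;> simp [deg, crownAdj, hsum]
  have hpath : ∑ x, ∑ y, ∑ x', ∑ y', pathInd (crownAdj m) Sum.isLeft x y x' y' =
      (m : ℝ) * (m - 1) * (m - 2) := by
    have h1 : ∀ i j i' j' : Fin m, pathInd (crownAdj m) Sum.isLeft (Sum.inl i) (Sum.inr j)
        (Sum.inl i') (Sum.inr j') =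
        if i = j then (if i ≠ i' ∧ i ≠ j' ∧ i' ≠ j' then 1 else 0) else 0 := by
      intro i j i' j'
      by_cases hij : i = j
      · subst hij
        have hsymm : (i' = i) = (i = i') := propext eq_comm
        by_cases h1 : i = i' <;> by_cases h2 : i = j' <;> by_cases h3 : i' = j' <;>
          simp [pathInd, crownAdj, hsymm, h1, h2, h3]
      · simp [pathInd, crownAdj, hij]
    have h2 := sum_distinct_triple fun _ : Fin m => true
    have z1 : ∀ i y x' y', pathInd (crownAdj m) Sum.isLeft (Sum.inr i) y x' y' = 0 := by
      simp [pathInd]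
    have z2 : ∀ x j x' y', pathInd (crownAdj m) Sum.isLeft x (Sum.inl j) x' y' = 0 := by
      simp [pathInd]
    have z3 : ∀ x y i y', pathInd (crownAdj m) Sum.isLeft x y (Sum.inr i) y' = 0 := by
      simp [pathInd]
    have z4 : ∀ x y x' j, pathInd (crownAdj m) Sum.isLeft x y x' (Sum.inl j) = 0 := by
      simp [pathInd]
    simp only [Fintype.sum_sum_type, z1, z2, z3, z4, h1, Finset.sum_const_zero, add_zero, zero_add]
    simp only [Finset.sum_ite_irrel, Finset.sum_const_zero, Finset.sum_ite_eq, Finset.mem_univ,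
      if_true]
    simpa using h2
  simp only [hpath, hdeg, Finset.sum_const, Finset.card_univ, Fintype.card_sum, Fintype.card_fin,
    nsmul_eq_mul]
  push_cast
  ring

/-- The graph `crownAdj` on the vertex set `Fin (m + m)`. -/
def crown (m : ℕ) : SimpleGraph (Fin (m + m)) :=
  ofBool (fun x y => crownAdj m (finSumFinEquiv.symm x) (finSumFinEquiv.symm y))
    (fun _ _ => crownAdj_symm m _ _) fun _ => crownAdj_irrefl m _

theorem edgeStatCount_crown (m : ℕ) :
    24 * (edgeStatCount 4 3 (crown m) : ℝ) = 8 * (m : ℝ) ^ 2 * (m - 1) * (m - 2) := by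
  rw [← quadCount_adjBool, crown, adjBool_ofBool, quadCount_comp_equiv, quadCount_crownAdj]

theorem crown_adj_left_right {m : ℕ} (i j : Fin m) :
    (crown m).Adj (finSumFinEquiv (Sum.inl i)) (finSumFinEquiv (Sum.inr j)) ↔ i ≠ j := by
  change crownAdj m _ _ = true ↔ _
  rw [Equiv.symm_apply_apply, Equiv.symm_apply_apply]
  simp [crownAdj]

/-- Indices `i`, `j` for which both vertices lie in the same parts of the blowup are equivalent. If `r`
is the representative of `i ≠ r`, the blowup treats `xᵢyᵢ` and `xᵢyᵣ` alike while the crown graph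
does not, so one of these two pairs is edited. There are at most `B.order ^ 2` representatives. -/
theorem le_editCount_crown (m : ℕ) (B : LoopPattern) (f : Fin (m + m) → Fin B.order) :
    m ≤ editCount (crown m) (B.blowup f) + B.order * B.order := by
  classical
  rcases Nat.eq_zero_or_pos m with h0 | h0
  · omega
  have : Nonempty (Fin m) := ⟨⟨0, h0⟩⟩
  set x : Fin m → Fin (m + m) := fun i => finSumFinEquiv (Sum.inl i) with hx
  set y : Fin m → Fin (m + m) := fun i => finSumFinEquiv (Sum.inr i) with hy
  have hxi : Function.Injective x := finSumFinEquiv.injective.comp Sum.inl_injective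
  have hyi : Function.Injective y := finSumFinEquiv.injective.comp Sum.inr_injective
  have hxy : ∀ i j, x i ≠ y j := fun i j h => Sum.inl_ne_inr (finSumFinEquiv.injective h)
  set c : Fin m → Fin B.order × Fin B.order := fun i => (f (x i), f (y i)) with hc
  set r : Fin m → Fin m := fun i => Function.invFun c (c i) with hr
  have hcr : ∀ i, c (r i) = c i := fun i => Function.invFun_eq ⟨i, rfl⟩
  have hfix : #{i | r i = i} ≤ B.order * B.order := by
    have h1 : Fintype.card (Fin B.order × Fin B.order) = B.order * B.order := by simp
    rw [← h1, ← Finset.card_univ]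
    refine Finset.card_le_card_of_injOn c (fun _ _ => mem_coe.2 (mem_univ _)) ?_
    intro i hi j hj hij
    have hi' : r i = i := (mem_filter.1 (mem_coe.1 hi)).2
    have hj' : r j = j := (mem_filter.1 (mem_coe.1 hj)).2
    rw [← hi', ← hj', hr]
    simp only [hij]
  have hmove : #{i | ¬ r i = i} ≤ editCount (crown m) (B.blowup f) := by
    have key : ∀ i, ¬ r i = i → ∃ j, s(x i, y j) ∈
        symmDiff (crown m).edgeSet (B.blowup f).edgeSet := by
      intro i hi
      have hB : B.Adj (f (x i)) (f (y i)) ↔ B.Adj (f (x i)) (f (y (r i))) := by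
        have : f (y (r i)) = f (y i) := congrArg Prod.snd (hcr i)
        rw [this]
      have a1 : ¬ (crown m).Adj (x i) (y i) := by
        rw [hx, hy, crown_adj_left_right]; simp
      have a2 : (crown m).Adj (x i) (y (r i)) := by
        rw [hx, hy, crown_adj_left_right]; exact fun h => hi h.symm
      by_cases hb : B.Adj (f (x i)) (f (y i))
      · exact ⟨i, Or.inr ⟨⟨hxy _ _, hb⟩, a1⟩⟩
      · exact ⟨r i, Or.inl ⟨a2, fun h => hb (hB.2 h.2)⟩⟩
    choose! j hj using key
    rw [editCount, Set.ncard_eq_toFinset_card']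
    refine Finset.card_le_card_of_injOn (fun i => s(x i, y (j i))) ?_ ?_
    · intro i hi
      rw [Set.coe_toFinset]
      exact hj i (mem_filter.1 (mem_coe.1 hi)).2
    · intro i _ k _ hik
      rcases Sym2.eq_iff.1 hik with ⟨h, -⟩ | ⟨h, -⟩
      · exact hxi h
      · exact absurd h (hxy _ _)
  have htot := Finset.card_filter_add_card_filter_not (s := (univ : Finset (Fin m)))
    (fun i => r i = i)
  rw [Finset.card_univ, Fintype.card_fin] at htot
  omega

theorem pow_four_le_choose {n : ℕ} (hn : 30 ≤ n) : (n : ℝ) ^ 4 / 2 ≤ 24 * (n.choose 4 : ℝ) := by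
  have h1 := Nat.pow_sub_le_descFactorial n 4
  rw [Nat.descFactorial_eq_factorial_mul_choose] at h1
  have h2 : ((n + 1 - 4 : ℕ) : ℝ) = n - 3 := by
    rw [Nat.cast_sub (by omega)]
    push_cast
    ring
  have h3 : ((n : ℝ) - 3) ^ 4 ≤ 24 * (n.choose 4 : ℝ) := by
    rw [← h2]
    exact_mod_cast h1
  have h4 : (30 : ℝ) ≤ n := by exact_mod_cast hn
  have h5 : (9 / 10 * (n : ℝ)) ^ 4 ≤ ((n : ℝ) - 3) ^ 4 := by
    gcongr
    linarith
  have h6 : (0 : ℝ) ≤ (n : ℝ) ^ 4 := by positivity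
  have h7 : (9 / 10 * (n : ℝ)) ^ 4 = 6561 / 10000 * (n : ℝ) ^ 4 := by ring
  linarith

/-- The crown graph misses the upper bound `N ^ 2 / 48` for the number of sets, where
`N = n ^ 2 - 3 n + 4` and `n = 2 m`, by at most `3 m ^ 2 / 4`. -/
theorem density_gap_crown_le : ∃ n₀ : ℕ, ∀ m : ℕ, n₀ ≤ m →
    (maxEdgeStatDensity 4 3 (m + m) - edgeStatDensity 4 3 (crown m)) * ((m + m : ℕ) : ℝ) ^ 2
      ≤ 9 := by
  obtain ⟨n₀, h⟩ := quadCount_le_of_isExtremal.{0}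
  refine ⟨max n₀ 15, fun m hm => ?_⟩
  have hm0 : n₀ ≤ m := (le_max_left _ _).trans hm
  have hm15 : 15 ≤ m := (le_max_right _ _).trans hm
  obtain ⟨G, hG⟩ := exists_edgeStatCount_eq_max 4 3 (m + m)
  have h1 := h (Fin (m + m)) (adjBool G) (adjBool_symm G) (adjBool_irrefl G)
    (isExtremal_adjBool (by rw [hG, Fintype.card_fin])) (by rw [Fintype.card_fin]; omega)
  rw [quadCount_adjBool, hG, Fintype.card_fin] at h1
  have h2 := edgeStatCount_crown m
  have h3 := pow_four_le_choose (n := m + m) (by omega)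
  rw [maxEdgeStatDensity, edgeStatDensity, Fintype.card_fin, ← sub_div]
  have h4 : (15 : ℝ) ≤ m := by exact_mod_cast hm15
  have h5 : ((m + m : ℕ) : ℝ) = 2 * m := by push_cast; ring
  rw [h5] at h1 h3 ⊢
  have hc : (0 : ℝ) < ((m + m).choose 4 : ℝ) := by
    have : (0 : ℝ) < (2 * m : ℝ) ^ 4 := by positivity
    linarith
  rw [div_mul_eq_mul_div, div_le_iff₀ hc]
  have gap : 24 * ((maxEdgeStatCount 4 3 (m + m) : ℝ) - edgeStatCount 4 3 (crown m)) ≤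
      18 * (m : ℝ) ^ 2 := by nlinarith
  have := mul_le_mul_of_nonneg_right gap (by positivity : (0 : ℝ) ≤ (2 * m) ^ 2)
  nlinarith

theorem not_isPerfectlyStable {P : Set LoopPattern} (hP : P.Finite) :
    ¬ IsPerfectlyStable 4 3 P := by
  rintro ⟨C, hC, H⟩
  obtain ⟨n₀, hgap⟩ := density_gap_crown_le
  obtain ⟨K, hK⟩ : ∃ K, ∀ B ∈ P, B.order ≤ K := by
    obtain ⟨K, hK⟩ := (hP.image LoopPattern.order).bddAbove
    exact ⟨K, fun B hB => hK ⟨B, hB, rfl⟩⟩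
  obtain ⟨m₁, hm₁⟩ := exists_nat_gt (9 * C + K * K)
  set m := max n₀ m₁
  have hm : 9 * C + K * K < (m : ℝ) := hm₁.trans_le (by exact_mod_cast le_max_right _ _)
  have hK0 : (0 : ℝ) ≤ (K : ℝ) * K := by positivity
  obtain ⟨B, hB, f, hf⟩ := H (m + m) (by push_cast; linarith) (crown m)
  have h1 := le_editCount_crown m B f
  have h2 : (B.order * B.order : ℕ) ≤ K * K := Nat.mul_le_mul (hK B hB) (hK B hB)
  have h3 : (m : ℝ) ≤ editCount (crown m) (B.blowup f) + K * K := by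
    exact_mod_cast h1.trans (Nat.add_le_add_left h2 _)
  have h4 := hgap m (le_max_left _ _)
  have h5 := mul_le_mul_of_nonneg_left h4 hC.le
  linarith

end EdgeStat

theorem theorem4p2 :
    (∃ n₀ : ℕ, ∀ (V : Type*) [Fintype V] (G : SimpleGraph V), n₀ ≤ Fintype.card V →
      edgeStatCount 4 3 G = maxEdgeStatCount 4 3 (Fintype.card V) →
        (∃ a b : ℕ, Nonempty
          (G ≃g SimpleGraph.sum (⊤ : SimpleGraph (Fin a)) (⊤ : SimpleGraph (Fin b)))) ∨
        (∃ a b : ℕ, Nonempty (G ≃g completeBipartiteGraph (Fin a) (Fin b)))) ∧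
    (∀ P : Set LoopPattern, P.Finite → ¬ IsPerfectlyStable 4 3 P) := by
  refine ⟨?_, fun P hP => EdgeStat.not_isPerfectlyStable hP⟩
  obtain ⟨n₀, h⟩ := EdgeStat.exists_bip_of_isExtremal
  refine ⟨n₀, fun V _ G hn hG => ?_⟩
  classical
  obtain ⟨t, ht | ht⟩ := h V (EdgeStat.adjBool G) (EdgeStat.adjBool_symm G)
    (EdgeStat.adjBool_irrefl G) (EdgeStat.isExtremal_adjBool hG) hn
  · exact Or.inr (EdgeStat.iso_completeBipartiteGraph ht)
  · exact Or.inl (EdgeStat.iso_sum_top ht)
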